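/- Let $\mathbb H^1=\mathbb R^3$ be the first Heisenberg group with the law $(x,y,z)(x',y',z')=(x+x',\,y+y',\,z+z'+2x'y-2xy')$, dilations $\delta_t(x,y,z)=(tx,ty,t^2z)$, left-invariant horizontal fields $X=\partial_x+2y\,\partial_z$, $Y=\partial_y-2x\,\partial_z$, homogeneous norm $\rho_\infty(x,y,z)=\max\{\sqrt{x^2+y^2},|z|^{1/2}\}$ and the left-invariant metric $d_\infty(A,B)=\rho_\infty(B^{-1}A)$. Let $\mathcal H^2_\infty$ be the $2$-dimensional Hausdorff measure of $d_\infty$, built from $\sum_i(\operatorname{diam}E_i)^2$ without further normalizing constant. For $n\ge 1$, a map $f:\mathbb H^1\to\mathbb R^n$ is horizontally differentiable at $A$ if there is a continuous group homomorphism $L=D_hf(A):\mathbb H^1\to\mathbb R^n$ with $L\circ\delta_t=tL$ for $t>0$ and $\|f(Ah)-f(A)-L(h)\|=o(d_\infty(h,0))$ as $h\to 0$. It is of class $C^1_H$ if it is horizontally differentiable everywhere and $A\mapsto D_hf(A)$ is continuous for the norm $\|L\|=\sup_{h\ne0}\|L(h)\|/\rho_\infty(h)$; it is of class $C^{1,\alpha}_H$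 if it is horizontally differentiable everywhere and, for some $M<\infty$, $\|D_hf(A)-D_hf(B)\|\le M\,d_\infty(A,B)^\alpha$ for all $A,B\in\mathbb H^1$. Let $F\in C^1_H(\mathbb H^1,\mathbb R^2)$ and let $\Gamma$ be a vertical curve of $F$: a compact simple arc $\Gamma\subset F^{-1}(0)$ such that $D_hF(A)$ is surjective for every $A\in\Gamma$. For $A,B\in\Gamma$ let $[A,B]\subset\Gamma$ be the closed sub-arc with endpoints $A$ and $B$. 1. Suppose that one component $f$ of $F$ satisfies, for all $A,B\in\mathbb H^1$, $$\max\{|Xf(A)-Xf(B)|,\ |Yf(A)-Yf(B)|\}\le m\big(d_\infty(A,B)^2\big),$$ where $m:[0,\infty)\to[0,\infty)$ is nondecreasing and $\sum_{k\ge0}m(r^{-k})<\infty$ for some $r>1$. Then $\Gamma$ is strongly Ahlfors regular: uniformly over the sub-arcs $[C,D]\subset\Gamma$, $$\mathcal H^2_\infty([C,D])=d_\infty(C,D)^2+o\big(d_\infty(C,D)^2\big)\quad\text{as } d_\infty(C,D)\to0.$$ 2. If one component of $F$ is of class $C^{1,\alpha}_H$ for some $\alpha>0$, then, uniformly over the sub-arcs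 $[A,B]\subset\Gamma$, $$\mathcal H^2_\infty([A,B])=d_\infty(A,B)^2\big(1+o(d_\infty(A,B)^{\alpha})\big)\quad\text{as } d_\infty(A,B)\to0.$$ 3. If $F$ is of class $C^{1,\alpha}_H$ for some $\alpha>0$, then there is a constant $C<\infty$ such that, for every sub-arc $[A,B]\subset\Gamma$, $$\big|\mathcal H^2_\infty([A,B])-d_\infty(A,B)^2\big|\le C\,d_\infty(A,B)^{2+2\alpha}.$$ In each case the measures of the sub-arcs concerned are finite. -/

import Mathlib

open MeasureTheory Filter Topology Set
open scoped NNReal ENNReal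

/-- The first Heisenberg group, in exponential coordinates of `ℝ³`. -/
@[ext]
structure Heis where
  x : ℝ
  y : ℝ
  z : ℝ

namespace Heis

/-- The group law
`(x, y, z)(x', y', z') = (x + x', y + y', z + z' + 2 x' y - 2 x y')`, with neutral element
`(0, 0, 0)`. -/
instance : Mul Heis :=
  ⟨fun A B => ⟨A.x + B.x, A.y + B.y, A.z + B.z + 2 * (B.x * A.y) - 2 * (A.x * B.y)⟩⟩

instance : One Heis := ⟨⟨0, 0, 0⟩⟩

instance : Inv Heis := ⟨fun A => ⟨-A.x, -A.y, -A.z⟩⟩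

@[simp] theorem mul_x (A B : Heis) : (A * B).x = A.x + B.x := rfl
@[simp] theorem mul_y (A B : Heis) : (A * B).y = A.y + B.y := rfl
@[simp] theorem mul_z (A B : Heis) :
    (A * B).z = A.z + B.z + 2 * (B.x * A.y) - 2 * (A.x * B.y) := rfl
@[simp] theorem one_x : (1 : Heis).x = 0 := rfl
@[simp] theorem one_y : (1 : Heis).y = 0 := rfl
@[simp] theorem one_z : (1 : Heis).z = 0 := rfl
@[simp] theorem inv_x (A : Heis) : (A⁻¹).x = -A.x := rfl
@[simp] theorem inv_y (A : Heis) : (A⁻¹).y = -A.y := rfl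
@[simp] theorem inv_z (A : Heis) : (A⁻¹).z = -A.z := rfl

instance : Group Heis :=
  Group.ofLeftAxioms
    (fun A B C => by ext <;> simp <;> ring)
    (fun A => by ext <;> simp)
    (fun A => by ext <;> simp)

/-- The dilations `δ_t (x, y, z) = (t x, t y, t² z)`. -/
def dil (t : ℝ) (A : Heis) : Heis := ⟨t * A.x, t * A.y, t ^ 2 * A.z⟩

/-- The homogeneous norm `ρ_∞(x, y, z) = max (√(x² + y²)) |z|^{1/2}`. -/
noncomputable def rho (A : Heis) : ℝ := max (√(A.x ^ 2 + A.y ^ 2)) (√|A.z|)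

theorem rho_nonneg (A : Heis) : 0 ≤ rho A := le_max_of_le_left (Real.sqrt_nonneg _)

theorem rho_one : rho 1 = 0 := by simp [rho]

theorem rho_inv (A : Heis) : rho A⁻¹ = rho A := by simp [rho]

theorem eq_one_of_rho_eq_zero {A : Heis} (h : rho A = 0) : A = 1 := by
  have h1 : √(A.x ^ 2 + A.y ^ 2) ≤ 0 := h ▸ le_max_left _ _
  have h2 : √|A.z| ≤ 0 := h ▸ le_max_right _ _
  rw [Real.sqrt_le_iff] at h1 h2
  ext
  · simp only [one_x]; nlinarith [h1.2, sq_nonneg A.x, sq_nonneg A.y]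
  · simp only [one_y]; nlinarith [h1.2, sq_nonneg A.x, sq_nonneg A.y]
  · simp only [one_z]; exact abs_eq_zero.1 (le_antisymm (by simpa using h2.2) (abs_nonneg _))

theorem rho_mul_le (A B : Heis) : rho (A * B) ≤ rho A + rho B := by
  have a0 := rho_nonneg A
  have b0 := rho_nonneg B
  have a1 : A.x ^ 2 + A.y ^ 2 ≤ rho A ^ 2 :=
    (Real.sqrt_le_left a0).1 (le_max_left _ _)
  have b1 : B.x ^ 2 + B.y ^ 2 ≤ rho B ^ 2 :=
    (Real.sqrt_le_left b0).1 (le_max_left _ _)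
  have a2 : |A.z| ≤ rho A ^ 2 := (Real.sqrt_le_left a0).1 (le_max_right _ _)
  have b2 : |B.z| ≤ rho B ^ 2 := (Real.sqrt_le_left b0).1 (le_max_right _ _)
  have key : (A.x ^ 2 + A.y ^ 2) * (B.x ^ 2 + B.y ^ 2) ≤ (rho A * rho B) ^ 2 := by
    rw [mul_pow]
    exact mul_le_mul a1 b1 (by positivity) (by positivity)
  have c1 : |A.x * B.x + A.y * B.y| ≤ rho A * rho B := by
    apply abs_le_of_sq_le_sq _ (by positivity)
    nlinarith [sq_nonneg (A.x * B.y - A.y * B.x)]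
  have c2 : |B.x * A.y - A.x * B.y| ≤ rho A * rho B := by
    apply abs_le_of_sq_le_sq _ (by positivity)
    nlinarith [sq_nonneg (A.x * B.x + A.y * B.y)]
  apply max_le
  · rw [Real.sqrt_le_left (by positivity)]
    simp only [mul_x, mul_y]
    nlinarith [(abs_le.1 c1).2]
  · rw [Real.sqrt_le_left (by positivity)]
    simp only [mul_z]
    rw [abs_le] at a2 b2 c2 ⊢
    constructor <;> nlinarith

/-- The left-invariant homogeneous metric `d_∞(A, B) = ρ_∞(B⁻¹ A)`. -/
noncomputable instance : MetricSpace Heis where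
  dist A B := rho (B⁻¹ * A)
  dist_self A := by
    change rho (A⁻¹ * A) = 0
    rw [inv_mul_cancel, rho_one]
  dist_comm A B := by
    change rho (B⁻¹ * A) = rho (A⁻¹ * B)
    rw [← rho_inv, mul_inv_rev, inv_inv]
  dist_triangle A B C := by
    change rho (C⁻¹ * A) ≤ rho (B⁻¹ * A) + rho (C⁻¹ * B)
    have h := rho_mul_le (C⁻¹ * B) (B⁻¹ * A)
    rw [mul_assoc, mul_inv_cancel_left] at h
    linarith
  eq_of_dist_eq_zero {A B} h := by
    have h' : B⁻¹ * A = 1 := eq_one_of_rho_eq_zero h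
    exact (inv_mul_eq_one.1 h').symm

theorem dist_def (A B : Heis) : dist A B = rho (B⁻¹ * A) := rfl

noncomputable instance : MeasurableSpace Heis := borel Heis

instance : BorelSpace Heis := ⟨rfl⟩

/-- The derivative `X f`, where `X = ∂_x + 2 y ∂_z`; its flow is `A ↦ A (t, 0, 0)`. -/
noncomputable def derivX (f : Heis → ℝ) (A : Heis) : ℝ :=
  deriv (fun t : ℝ => f (A * ⟨t, 0, 0⟩)) 0

/-- The derivative `Y f`, where `Y = ∂_y - 2 x ∂_z`; its flow is `A ↦ A (0, t, 0)`. -/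
noncomputable def derivY (f : Heis → ℝ) (A : Heis) : ℝ :=
  deriv (fun t : ℝ => f (A * ⟨0, t, 0⟩)) 0

section Differentiability

variable {E : Type*} [NormedAddCommGroup E] [NormedSpace ℝ E]

/-- Horizontal homomorphisms from the Heisenberg group to a normed space `E` (an abelian Carnot
group with dilations `v ↦ t v`): continuous group homomorphisms commuting with the dilations. -/
structure IsHorizontalHom (L : Heis → E) : Prop where
  map_mul : ∀ A B, L (A * B) = L A + L B
  map_dil : ∀ t : ℝ, 0 < t → ∀ A, L (dil t A) = t • L A
  continuous : Continuous L

/-- `L` is the horizontal (Pansu) differential of `f` at `A`. -/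
structure HasHorizontalDiffAt (f : Heis → E) (A : Heis) (L : Heis → E) : Prop where
  isHorizontalHom : IsHorizontalHom L
  isLittleO : (fun h : Heis => f (A * h) - f A - L h) =o[𝓝 1] (fun h : Heis => dist h 1)

/-- `‖L‖ ≤ c` for the norm `‖L‖ = sup_{A ≠ 1} ‖L A‖ / ρ_∞(A)`. -/
def NormLE (L : Heis → E) (c : ℝ) : Prop := ∀ A, ‖L A‖ ≤ c * rho A

/-- The class `C¹_H`: `f` is horizontally differentiable at every point and its horizontal
differential depends continuously on the point. -/
def IsC1H (f : Heis → E) : Prop :=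
  ∃ D : Heis → Heis → E, (∀ A, HasHorizontalDiffAt f A (D A)) ∧
    ∀ A, ∀ ε > 0, ∃ δ > 0, ∀ B, dist A B < δ → NormLE (fun h => D B h - D A h) ε

/-- The class `C^{1,α}_H`: `f` is horizontally differentiable at every point and its horizontal
differential is `α`-Hölder on the whole group. -/
def IsC1AlphaH (α : ℝ) (f : Heis → E) : Prop :=
  ∃ D : Heis → Heis → E, (∀ A, HasHorizontalDiffAt f A (D A)) ∧
    ∃ M : ℝ, ∀ A B, NormLE (fun h => D B h - D A h) (M * dist A B ^ α)

/-- `γ`, restricted to `[0, 1]`, parametrizes a vertical curve of `F`: a simple arc contained in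
the level set `F⁻¹(0)`, at every point of which the horizontal differential of `F` is
surjective. -/
structure IsVerticalCurve (F : Heis → E) (γ : ℝ → Heis) : Prop where
  continuousOn : ContinuousOn γ (Icc 0 1)
  injOn : InjOn γ (Icc 0 1)
  mem_level : ∀ t ∈ Icc (0 : ℝ) 1, F (γ t) = 0
  surjective : ∀ t ∈ Icc (0 : ℝ) 1, ∃ L, HasHorizontalDiffAt F (γ t) L ∧ Function.Surjective L

end Differentiability

/-- `|𝓗²_∞([A, B]) - d_∞(A, B)²| ≤ e`, the measure being finite, for the sub-arc `[A, B]` of `γ`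
between `A = γ s` and `B = γ t`. -/
def ArcEstimate (γ : ℝ → Heis) (s t e : ℝ) : Prop :=
  μH[2] (γ '' Icc s t) ≠ ∞ ∧
    |(μH[2] (γ '' Icc s t)).toReal - dist (γ s) (γ t) ^ 2| ≤ e

/-- Strong Ahlfors regularity of the arc `γ`: `𝓗²_∞([A, B]) = d_∞(A, B)² + o(d_∞(A, B)²)` as
`d_∞(A, B) → 0`, uniformly over the sub-arcs `[A, B]`. -/
def IsStronglyAhlforsRegular (γ : ℝ → Heis) : Prop :=
  ∀ ε > 0, ∃ δ > 0, ∀ s t, 0 ≤ s → s ≤ t → t ≤ 1 → dist (γ s) (γ t) < δ →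
    ArcEstimate γ s t (ε * dist (γ s) (γ t) ^ 2)

end Heis

/-! Write `Q s t` for the squared distance between `γ s` and `γ t`. The theorem says that `Q` is
almost additive along the arc, and that an almost additive `Q` is almost the two-dimensional
Hausdorff measure.

Geometry. On a level set of a `C¹_H` map, the mean value inequality along horizontal paths makes `D
A (A⁻¹ * B)` small compared with the distance. Surjectivity on the compact arc turns this into
smallness of the horizontal part of `A⁻¹ * B`, so at small scales `Q` is the absolute value of a
vertical coordinate, whose sign is constant by connectedness. The group law then gives the defect `Q
s t - Q s u - Q u t` exactly: up to sign it is twice the cross product of the horizontal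
displacements seen from the middle point `γ u`. Expressed through the differential of `F` at `γ u`,
it is a difference of two products, each with one factor from either component
(`exists_abs_defect_le`). Hence a modulus for one component suffices: the other factor is `o` of the
distance merely because `F` is `C¹_H`. When both components are Hölder the two gains multiply, which
explains the exponent `2α`.

Sewing. Points are removed from a partition one at a time, always between two short neighbouring
pieces. With `k + 2` pieces left, the removed point costs at most the defect at size `6Q / (k + 1)`,
so the total error is a Dini sum (`abs_chainSum_sub_le`). Cauchy condensation identifies its
convergence with the geometric summability of the modulus.

Measure. Near additivity bounds the diameter of a small arc by its chord, and fine covers give the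
upper bound. For the lower bound, an infimum of chain sums serves as a coordinate on the arc: it is
Hölder of exponent 2 with constant near 1, and its range is an interval of length nearly `Q`. On
finer and finer partitions the multiplicative losses disappear, so that only the chain-sum error
remains (`abs_hausdorffMeasure_arc_sub_le`). -/

/-! ### Sewing of almost additive two-parameter functions -/

/-- `p 0 ≤ p 1 ≤ ⋯ ≤ p N` is a partition of `[s, t]` with `N` pieces. -/
structure IsPartition (p : ℕ → ℝ) (N : ℕ) (s t : ℝ) : Prop where
  mono : Monotone p
  left : p 0 = s
  right : p N = t

/-- The sum of the two-parameter function `Q` over the pieces of a partition. -/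
def chainSum (Q : ℝ → ℝ → ℝ) (p : ℕ → ℝ) (N : ℕ) : ℝ := ∑ k ∈ Finset.range N, Q (p k) (p (k + 1))

/-- The sequence `p` without its term of index `i + 1`. -/
def skipAfter (p : ℕ → ℝ) (i k : ℕ) : ℝ := if k ≤ i then p k else p (k + 1)

theorem IsPartition.mem_Icc {p : ℕ → ℝ} {N : ℕ} {s t : ℝ} (h : IsPartition p N s t) {k : ℕ}
    (hk : k ≤ N) : p k ∈ Icc s t :=
  ⟨h.left ▸ h.mono (Nat.zero_le k), h.right ▸ h.mono hk⟩

theorem monotone_skipAfter {p : ℕ → ℝ} (hp : Monotone p) (i : ℕ) : Monotone (skipAfter p i) := by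
  intro a b hab
  unfold skipAfter
  split_ifs
  · exact hp hab
  · exact hp (by omega)
  · omega
  · exact hp (by omega)

theorem IsPartition.skipAfter {p : ℕ → ℝ} {n i : ℕ} {s t : ℝ} (h : IsPartition p (n + 2) s t)
    (hi : i ≤ n) : IsPartition (skipAfter p i) (n + 1) s t where
  mono := monotone_skipAfter h.mono i
  left := by simp [_root_.skipAfter, h.left]
  right := by
    rw [_root_.skipAfter, if_neg (by omega)]
    exact h.right

theorem chainSum_skipAfter (Q : ℝ → ℝ → ℝ) (p : ℕ → ℝ) {n i : ℕ} (hi : i ≤ n) :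
    chainSum Q (skipAfter p i) (n + 1) = chainSum Q p (n + 2) - Q (p i) (p (i + 1))
      - Q (p (i + 1)) (p (i + 2)) + Q (p i) (p (i + 2)) := by
  induction n, hi using Nat.le_induction with
  | base =>
    have : ∀ k ∈ Finset.range i, Q (skipAfter p i k) (skipAfter p i (k + 1)) =
        Q (p k) (p (k + 1)) := by
      intro k hk
      have := Finset.mem_range.1 hk
      rw [skipAfter, skipAfter, if_pos (by omega), if_pos (by omega)]
    rw [chainSum, chainSum, Finset.sum_range_succ, Finset.sum_range_succ, Finset.sum_range_succ,
      Finset.sum_congr rfl this]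
    rw [skipAfter, skipAfter, if_pos le_rfl, if_neg (by omega)]
    ring
  | succ n hn ih =>
    have h1 : chainSum Q (skipAfter p i) (n + 1 + 1) =
        chainSum Q (skipAfter p i) (n + 1) + Q (p (n + 2)) (p (n + 3)) := by
      rw [chainSum, Finset.sum_range_succ, skipAfter, skipAfter, if_neg (by omega),
        if_neg (by omega)]
      rfl
    have h2 : chainSum Q p (n + 1 + 2) = chainSum Q p (n + 2) + Q (p (n + 2)) (p (n + 3)) := by
      rw [chainSum, Finset.sum_range_succ]
      rfl
    rw [h1, h2, ih]
    ring

/-- In a nonempty list of `n + 2` nonnegative numbers some two neighbours are both at most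
`2 / (n + 1)` times the sum. -/
theorem exists_max_neighbours_le {f : ℕ → ℝ} {n : ℕ} (hf : ∀ k < n + 2, 0 ≤ f k) :
    ∃ i ≤ n, (n + 1) * max (f i) (f (i + 1)) ≤ 2 * ∑ k ∈ Finset.range (n + 2), f k := by
  by_contra! h
  have h1 : ∑ i ∈ Finset.range (n + 1), (n + 1) * max (f i) (f (i + 1)) ≤
      (n + 1) * (2 * ∑ k ∈ Finset.range (n + 2), f k) := by
    rw [← Finset.mul_sum]
    gcongr
    calc ∑ i ∈ Finset.range (n + 1), max (f i) (f (i + 1))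
        ≤ ∑ i ∈ Finset.range (n + 1), (f i + f (i + 1)) := by
          apply Finset.sum_le_sum
          intro i hi
          have := Finset.mem_range.1 hi
          exact max_le_add_of_nonneg (hf i (by omega)) (hf (i + 1) (by omega))
      _ ≤ _ := by
          rw [Finset.sum_add_distrib, two_mul]
          have e1 := Finset.sum_range_succ f (n + 1)
          have e2 := Finset.sum_range_succ' f (n + 1)
          have := hf (n + 1) (by omega)
          have := hf 0 (by omega)
          linarith
  have h2 : ∑ i ∈ Finset.range (n + 1), 2 * ∑ k ∈ Finset.range (n + 2), f k <
      ∑ i ∈ Finset.range (n + 1), (n + 1) * max (f i) (f (i + 1)) :=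
    Finset.sum_lt_sum_of_nonempty (by simp) fun i hi =>
      h i (by have := Finset.mem_range.1 hi; omega)
  rw [Finset.sum_const, Finset.card_range, nsmul_eq_mul] at h2
  push_cast at h2
  linarith

/-- The sewing estimate (point removal): a nonnegative two-parameter function that is additive up
to a small summable error is compared with its sums over arbitrary partitions. -/
theorem abs_chainSum_sub_le {Q : ℝ → ℝ → ℝ} {err : ℝ → ℝ} {s t : ℝ}
    (hQ : ∀ x y, 0 ≤ Q x y) (herr : MonotoneOn err (Ici 0))
    (h8 : ∀ x y z, s ≤ x → x ≤ y → y ≤ z → z ≤ t →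
      |Q x z - Q x y - Q y z| ≤ max (Q x y) (Q y z) / 8)
    (hE : ∀ x y z, s ≤ x → x ≤ y → y ≤ z → z ≤ t →
      |Q x z - Q x y - Q y z| ≤ err (max (Q x y) (Q y z)))
    (hS : ∀ n : ℕ, ∑ k ∈ Finset.range n, err (6 * Q s t / (k + 1)) ≤ Q s t)
    (n : ℕ) {p : ℕ → ℝ} (hp : IsPartition p (n + 1) s t) :
    |chainSum Q p (n + 1) - Q s t| ≤ ∑ k ∈ Finset.range n, err (6 * Q s t / (k + 1)) := by
  induction n generalizing p with
  | zero => simp [chainSum, hp.left, ← hp.right]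
  | succ n ih =>
    obtain ⟨i, hin, hi⟩ := exists_max_neighbours_le (f := fun k => Q (p k) (p (k + 1))) (n := n)
      (fun k _ => hQ _ _)
    change _ ≤ 2 * chainSum Q p (n + 2) at hi
    have ih' := ih (hp.skipAfter hin)
    have hsk := chainSum_skipAfter Q p hin
    have a1 : s ≤ p i := (hp.mem_Icc (by omega)).1
    have a2 : p (i + 2) ≤ t := (hp.mem_Icc (by omega)).2
    have b1 := h8 _ _ _ a1 (hp.mono (Nat.le_succ i)) (hp.mono (Nat.le_succ (i + 1))) a2
    have b2 := hE _ _ _ a1 (hp.mono (Nat.le_succ i)) (hp.mono (Nat.le_succ (i + 1))) a2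
    simp only [Nat.succ_eq_add_one, add_assoc, Nat.reduceAdd] at b1 b2 hi
    set M := max (Q (p i) (p (i + 1))) (Q (p (i + 1)) (p (i + 2))) with hM
    have M0 : 0 ≤ M := le_max_of_le_left (hQ _ _)
    have hn : (0 : ℝ) ≤ n := Nat.cast_nonneg n
    have hst := hQ s t
    have hS' := hS n
    -- By induction and `hS` the shortened chain is at most `2 Q s t`. The defect is at most `M /
    -- 8`, hence at most a quarter of the longer chain, and is absorbed in the left-hand side; this
    -- is the only role of `h8`.
    have hSle : chainSum Q p (n + 2) ≤ 3 * Q s t := by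
      have e1 := (abs_le.1 b1).2
      have e2 := (abs_le.1 ih').2
      have e1' := (abs_le.1 b1).1
      nlinarith [mul_nonneg hn M0]
    have hMle : M ≤ 6 * Q s t / (n + 1) := by
      rw [le_div_iff₀ (by positivity)]
      linarith
    have hlast := b2.trans (herr (mem_Ici.2 M0) (mem_Ici.2 (M0.trans hMle)) hMle)
    rw [Finset.sum_range_succ]
    rw [show n + 1 + 1 = n + 2 from rfl]
    rw [abs_le] at ih' hlast ⊢
    constructor <;> linarith [ih'.1, ih'.2, hlast.1, hlast.2]

/-! ### Hausdorff measure of an arc with nearly additive squared distance -/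

/-- `Q` is additive up to the relative error `κ` along all partitions of `[s, t]`. -/
def NearlyAdditive (Q : ℝ → ℝ → ℝ) (κ s t : ℝ) : Prop :=
  ∀ n p, IsPartition p n s t → |chainSum Q p n - Q s t| ≤ κ * Q s t

/-- The square of the distance between two points of a curve. -/
def sqDist {X : Type*} [PseudoMetricSpace X] (γ : ℝ → X) (s t : ℝ) : ℝ := dist (γ s) (γ t) ^ 2

theorem sqDist_nonneg {X : Type*} [PseudoMetricSpace X] (γ : ℝ → X) (s t : ℝ) :
    0 ≤ sqDist γ s t := sq_nonneg _

/-- Drop the outer pieces of the three-piece partition through `u` and `v`. For `sqDist` this bounds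
the diameter of an arc by its chord. -/
theorem NearlyAdditive.le_of_subinterval {Q : ℝ → ℝ → ℝ} {κ s t u v : ℝ}
    (h : NearlyAdditive Q κ s t) (hQ : ∀ x y, 0 ≤ Q x y) (hsu : s ≤ u) (huv : u ≤ v)
    (hvt : v ≤ t) : Q u v ≤ (1 + κ) * Q s t := by
  let p : ℕ → ℝ := fun k => if k = 0 then s else if k = 1 then u else if k = 2 then v else t
  have hp : IsPartition p 3 s t := by
    refine ⟨monotone_nat_of_le_succ fun k => ?_, by simp [p], by simp [p]⟩
    rcases k with _ | _ | _ | k <;> simp [p, *]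
  have h1 := (abs_le.1 (h 3 p hp)).2
  have e : chainSum Q p 3 = Q s u + Q u v + Q v t := by
    simp [chainSum, Finset.sum_range_succ, p]
  rw [e] at h1
  linarith [hQ s u, hQ v t]

section Curve

variable {X : Type*} [MetricSpace X] {γ : ℝ → X} {a b : ℝ}

/-- The infimum of the sums of `Q` over all partitions of intervals `[a, v]` with `u ≤ v ≤ b`. -/
noncomputable def infChain (Q : ℝ → ℝ → ℝ) (a b u : ℝ) : ℝ :=
  sInf {S | ∃ v ∈ Icc u b, ∃ n p, IsPartition p n a v ∧ S = chainSum Q p n}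

theorem chainSum_nonneg {Q : ℝ → ℝ → ℝ} (hQ : ∀ x y, 0 ≤ Q x y) (p : ℕ → ℝ) (n : ℕ) :
    0 ≤ chainSum Q p n := Finset.sum_nonneg fun _ _ => hQ _ _

theorem bddBelow_chains {Q : ℝ → ℝ → ℝ} (hQ : ∀ x y, 0 ≤ Q x y) (a b u : ℝ) :
    BddBelow {S | ∃ v ∈ Icc u b, ∃ n p, IsPartition p n a v ∧ S = chainSum Q p n} :=
  ⟨0, by rintro _ ⟨v, _, n, p, _, rfl⟩; exact chainSum_nonneg hQ p n⟩

theorem isPartition_const (a : ℝ) : IsPartition (fun _ => a) 0 a a := ⟨monotone_const, rfl, rfl⟩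

/-- A partition of `[s, v]` followed by the piece `[v, t]`. -/
theorem IsPartition.snoc {p : ℕ → ℝ} {n : ℕ} {s v t : ℝ} (h : IsPartition p n s v) (hvt : v ≤ t)
    (Q : ℝ → ℝ → ℝ) :
    ∃ p', IsPartition p' (n + 1) s t ∧ chainSum Q p' (n + 1) = chainSum Q p n + Q v t := by
  refine ⟨fun k => if k ≤ n then p k else t, ⟨?_, by simp [h.left], by simp⟩, ?_⟩
  · refine monotone_nat_of_le_succ fun k => ?_
    split_ifs with h1 h2
    · exact h.mono (Nat.le_succ k)
    · exact (h.mem_Icc h1).2.trans hvt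
    · omega
    · exact le_rfl
  · rw [chainSum, Finset.sum_range_succ]
    congr 1
    · refine Finset.sum_congr rfl fun k hk => ?_
      have := Finset.mem_range.1 hk
      rw [if_pos (by omega), if_pos (by omega)]
    · simp [h.right]

theorem chains_nonempty (Q : ℝ → ℝ → ℝ) {a b u : ℝ} (hab : a ≤ b) (hub : u ≤ b) :
    {S | ∃ v ∈ Icc u b, ∃ n p, IsPartition p n a v ∧ S = chainSum Q p n}.Nonempty := by
  obtain ⟨p, hp, -⟩ := (isPartition_const a).snoc hab Q
  exact ⟨_, b, ⟨hub, le_rfl⟩, _, p, hp, rfl⟩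

theorem infChain_left {Q : ℝ → ℝ → ℝ} (hQ : ∀ x y, 0 ≤ Q x y) (hab : a ≤ b) :
    infChain Q a b a = 0 := by
  apply le_antisymm
  · exact csInf_le (bddBelow_chains hQ a b a)
      ⟨a, ⟨le_rfl, hab⟩, 0, _, isPartition_const a, by simp [chainSum]⟩
  · apply le_csInf (chains_nonempty Q hab hab)
    rintro _ ⟨v, _, n, p, _, rfl⟩
    exact chainSum_nonneg hQ p n

theorem le_infChain_right {Q : ℝ → ℝ → ℝ} {κ : ℝ} (hab : a ≤ b) (h : NearlyAdditive Q κ a b) :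
    (1 - κ) * Q a b ≤ infChain Q a b b := by
  apply le_csInf (chains_nonempty Q hab le_rfl)
  rintro _ ⟨v, hv, n, p, hp, rfl⟩
  obtain rfl : v = b := le_antisymm hv.2 hv.1
  linarith [(abs_le.1 (h n p hp)).1]

/-- This is why the right endpoint in `infChain` ranges over `[u, b]`: the set of admissible chains
shrinks as `u` grows. -/
theorem infChain_mono {Q : ℝ → ℝ → ℝ} (hQ : ∀ x y, 0 ≤ Q x y) (hab : a ≤ b) {s t : ℝ}
    (hst : s ≤ t) (htb : t ≤ b) : infChain Q a b s ≤ infChain Q a b t := by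
  apply csInf_le_csInf (bddBelow_chains hQ a b s) (chains_nonempty Q hab htb)
  rintro S ⟨v, hv, h⟩
  exact ⟨v, ⟨hst.trans hv.1, hv.2⟩, h⟩

/-- A chain ending beyond `t` is already admissible for `t`. One ending at `v` in `[s, t]` is
completed by the piece `[v, t]`, whose cost is controlled by near additivity on `[s, t]`. -/
theorem infChain_le_add {Q : ℝ → ℝ → ℝ} (hQ : ∀ x y, 0 ≤ Q x y) (hab : a ≤ b) {κ s t : ℝ}
    (hκ : 0 ≤ κ) (h : NearlyAdditive Q κ s t) (hst : s ≤ t) (htb : t ≤ b) :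
    infChain Q a b t ≤ infChain Q a b s + (1 + κ) * Q s t := by
  rw [← sub_le_iff_le_add]
  apply le_csInf (chains_nonempty Q hab (hst.trans htb))
  rintro S ⟨v, hv, n, p, hp, rfl⟩
  rw [sub_le_iff_le_add]
  rcases le_total t v with htv | hvt
  · have := csInf_le (bddBelow_chains hQ a b t) ⟨v, ⟨htv, hv.2⟩, n, p, hp, rfl⟩
    have h0 : 0 ≤ (1 + κ) * Q s t := mul_nonneg (by linarith) (hQ s t)
    exact this.trans (by linarith)
  · obtain ⟨p', hp', hS⟩ := hp.snoc hvt Q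
    have := csInf_le (bddBelow_chains hQ a b t) ⟨t, ⟨le_rfl, htb⟩, n + 1, p', hp', rfl⟩
    have h1 := h.le_of_subinterval hQ hv.1 hvt le_rfl
    exact this.trans (by linarith)

variable [MeasurableSpace X] [BorelSpace X]

/-- Lower bound for the Hausdorff measure of an arc along which the squared distance is nearly
additive at all scales. -/
theorem ofReal_mul_sqDist_le_hausdorffMeasure (hab : a ≤ b) (hc : ContinuousOn γ (Icc a b))
    (hi : InjOn γ (Icc a b)) {κ : ℝ} (hκ : 0 ≤ κ)
    (h : ∀ s t, a ≤ s → s ≤ t → t ≤ b → NearlyAdditive (sqDist γ) κ s t) :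
    ENNReal.ofReal ((1 - κ) * sqDist γ a b) ≤
      ENNReal.ofReal (1 + κ) * μH[2] (γ '' Icc a b) := by
  have hQ := sqDist_nonneg γ
  set I := infChain (sqDist γ) a b with hI
  let T : X → ℝ := fun P => I (Function.invFunOn γ (Icc a b) P)
  have hT : ∀ u ∈ Icc a b, T (γ u) = I u := fun u hu => by
    simp only [T]
    rw [hi.leftInvOn_invFunOn hu]
  have key : ∀ s ∈ Icc a b, ∀ t ∈ Icc a b, s ≤ t →
      |I s - I t| ≤ (1 + κ) * dist (γ s) (γ t) ^ 2 := by
    intro s hs t ht hst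
    have h1 := infChain_mono hQ hab hst ht.2
    have h2 := infChain_le_add hQ hab hκ (h s t hs.1 hst ht.2) hst ht.2
    rw [abs_sub_comm, abs_of_nonneg (by linarith)]
    simp only [sqDist] at h2 ⊢
    linarith
  -- Exponent 2 maps two-dimensional measure on the arc to length on the line, with factor `1 + κ`.
  have hH : HolderOnWith (1 + κ).toNNReal 2 T (γ '' Icc a b) := by
    rintro _ ⟨s, hs, rfl⟩ _ ⟨t, ht, rfl⟩
    rw [hT s hs, hT t ht, edist_dist, edist_dist, Real.dist_eq]
    have : |I s - I t| ≤ (1 + κ) * dist (γ s) (γ t) ^ 2 := by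
      rcases le_total s t with hst | hst
      · exact key s hs t ht hst
      · rw [abs_sub_comm, dist_comm]
        exact key t ht s hs hst
    calc ENNReal.ofReal |I s - I t| ≤ ENNReal.ofReal ((1 + κ) * dist (γ s) (γ t) ^ 2) :=
          ENNReal.ofReal_le_ofReal this
      _ = _ := by
          rw [ENNReal.ofReal_mul (by linarith), ENNReal.ofReal_pow dist_nonneg]
          norm_num
          rfl
  have hIc : ContinuousOn I (Icc a b) := by
    have := (hH.continuousOn (by norm_num)).comp hc (mapsTo_image γ _)
    exact this.congr fun u hu => (hT u hu).symm
  -- The Hölder bound makes `I` continuous, so its values fill the interval from `I a = 0` to `I b`.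
  have himg : Icc 0 (I b) ⊆ T '' (γ '' Icc a b) := by
    have h1 := intermediate_value_Icc hab hIc
    rw [hI, infChain_left hQ hab, ← hI] at h1
    intro y hy
    obtain ⟨u, hu, rfl⟩ := h1 hy
    exact ⟨γ u, ⟨u, hu, rfl⟩, hT u hu⟩
  have hm := hH.hausdorffMeasure_image_le (by norm_num) (d := 1) zero_le_one
  rw [hausdorffMeasure_real] at hm
  calc ENNReal.ofReal ((1 - κ) * sqDist γ a b) ≤ ENNReal.ofReal (I b - 0) := by
        rw [sub_zero]
        exact ENNReal.ofReal_le_ofReal (le_infChain_right hab (h a b le_rfl hab le_rfl))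
    _ = volume (Icc 0 (I b)) := Real.volume_Icc.symm
    _ ≤ volume (T '' (γ '' Icc a b)) := measure_mono himg
    _ ≤ _ := by
        refine hm.trans (le_of_eq ?_)
        simp only [ENNReal.rpow_one, NNReal.coe_ofNat, mul_one]
        rfl

/-- By injectivity the two arcs share only the point `γ u`, which is null in dimension 2. -/
theorem hausdorffMeasure_arc_add (hc : ContinuousOn γ (Icc a b)) (hi : InjOn γ (Icc a b))
    {s u t : ℝ} (has : a ≤ s) (hsu : s ≤ u) (hut : u ≤ t) (htb : t ≤ b) :
    (μH[2] (γ '' Icc s t) : ℝ≥0∞) = μH[2] (γ '' Icc s u) + μH[2] (γ '' Icc u t) := by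
  have := Measure.nullSingletonClass_hausdorff X (d := 2) (by norm_num)
  rw [← Icc_union_Icc_eq_Icc hsu hut, image_union]
  apply measure_union₀
  · exact (isCompact_Icc.image_of_continuousOn
      (hc.mono (Icc_subset_Icc (has.trans hsu) htb))).isClosed.measurableSet.nullMeasurableSet
  · refine measure_mono_null ?_ (measure_singleton (γ u))
    rintro _ ⟨⟨v, hv, rfl⟩, ⟨w, hw, hvw⟩⟩
    have : w = v := hi ⟨(has.trans hsu).trans hw.1, hw.2.trans htb⟩
      ⟨has.trans hv.1, hv.2.trans (hut.trans htb)⟩ hvw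
    subst this
    rw [le_antisymm hv.2 hw.1]
    rfl

theorem sum_hausdorffMeasure_arc (hc : ContinuousOn γ (Icc a b)) (hi : InjOn γ (Icc a b))
    {p : ℕ → ℝ} (hp : Monotone p) (h0 : a ≤ p 0) (n : ℕ) (hn : p n ≤ b) :
    ∑ k ∈ Finset.range n, (μH[2] (γ '' Icc (p k) (p (k + 1))) : ℝ≥0∞) ≤
      μH[2] (γ '' Icc (p 0) (p n)) := by
  induction n with
  | zero => simp
  | succ n ih =>
    rw [Finset.sum_range_succ, hausdorffMeasure_arc_add hc hi h0 (hp (Nat.zero_le n))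
      (hp (Nat.le_succ n)) hn]
    gcongr
    exact ih ((hp (Nat.le_succ n)).trans hn)

/-- The partition of `[a, b]` into `n` equal pieces. -/
noncomputable def uniformPartition (a b : ℝ) (n k : ℕ) : ℝ := a + (b - a) * k / n

theorem isPartition_uniformPartition (hab : a ≤ b) {n : ℕ} (hn : n ≠ 0) :
    IsPartition (uniformPartition a b n) n a b := by
  have hn' : (0 : ℝ) < n := by positivity
  refine ⟨fun i j hij => ?_, by simp [uniformPartition], ?_⟩
  · unfold uniformPartition
    have : 0 ≤ b - a := by linarith
    have : (i : ℝ) ≤ j := by exact_mod_cast hij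
    gcongr
  · unfold uniformPartition
    field_simp
    ring

theorem uniformPartition_succ_sub (a b : ℝ) (n k : ℕ) :
    uniformPartition a b n (k + 1) - uniformPartition a b n k = (b - a) / n := by
  unfold uniformPartition
  push_cast
  ring

theorem eventually_uniformPartition_succ_sub_lt (a b : ℝ) {δ : ℝ} (hδ : 0 < δ) :
    ∀ᶠ n : ℕ in atTop, ∀ k,
      uniformPartition a b n (k + 1) - uniformPartition a b n k < δ := by
  have := (tendsto_const_div_atTop_nhds_zero_nat (b - a)).eventually_lt_const hδ
  filter_upwards [this] with n hn k
  rwa [uniformPartition_succ_sub]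

/-- Cover by the images of equal parameter intervals. Near additivity on each short piece compares
its squared diameter with its chord, and `he` bounds the sum of the chords. The relative error `κ`
is needed only on short pieces, while `e` concerns the whole arc. -/
theorem hausdorffMeasure_arc_le (hab : a ≤ b) (hc : ContinuousOn γ (Icc a b)) {e κ δ : ℝ}
    (hκ : 0 ≤ κ) (hδ : 0 < δ)
    (h : ∀ s t, a ≤ s → s ≤ t → t ≤ b → t - s < δ → NearlyAdditive (sqDist γ) κ s t)
    (he : ∀ n p, IsPartition p n a b → |chainSum (sqDist γ) p n - sqDist γ a b| ≤ e) :
    μH[2] (γ '' Icc a b) ≤ ENNReal.ofReal ((1 + κ) * (sqDist γ a b + e)) := by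
  let A : (n : ℕ) → Fin n → Set X := fun n k =>
    γ '' Icc (uniformPartition a b n k) (uniformPartition a b n (k + 1))
  have huc := isCompact_Icc.uniformContinuousOn_of_continuous hc
  have hA : Tendsto (fun n => ⨆ k, Metric.ediam (A n k)) atTop (𝓝 0) := by
    rw [ENNReal.tendsto_nhds_zero]
    intro ε hε
    obtain ⟨η, hη, hη'⟩ := EMetric.uniformContinuousOn_iff.1 huc ε hε
    obtain ⟨η₁, h1, h2⟩ := ENNReal.lt_iff_exists_real_btwn.1 hη
    have hη₁ : 0 < η₁ := by
      by_contra hcon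
      simp [ENNReal.ofReal_of_nonpos (not_lt.1 hcon)] at h2
    filter_upwards [eventually_uniformPartition_succ_sub_lt a b hη₁, eventually_gt_atTop 0]
      with n hn hn0
    refine iSup_le fun k => Metric.ediam_le ?_
    have hp := isPartition_uniformPartition hab hn0.ne'
    rintro _ ⟨x, hx, rfl⟩ _ ⟨y, hy, rfl⟩
    have hl := (hp.mem_Icc (k := k) (by omega)).1
    have hr := (hp.mem_Icc (k := k + 1) (by omega)).2
    refine (hη' ⟨hl.trans hx.1, hx.2.trans hr⟩ ⟨hl.trans hy.1, hy.2.trans hr⟩ ?_).le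
    refine lt_of_le_of_lt ?_ h2.2
    rw [edist_dist]
    apply ENNReal.ofReal_le_ofReal
    rw [Real.dist_eq]
    have := hn k
    rw [abs_le]
    constructor <;> linarith [hx.1, hx.2, hy.1, hy.2]
  refine (Measure.hausdorffMeasure_le_liminf_sum 2 (γ '' Icc a b) _ hA A
    (Eventually.of_forall fun n k => le_iSup (fun k => Metric.ediam (A n k)) k) ?_).trans ?_
  · filter_upwards [eventually_gt_atTop 0] with n hn0
    have hp := isPartition_uniformPartition hab hn0.ne'
    rintro _ ⟨x, hx, rfl⟩
    -- The alternative `x = a` is the base case, where no piece is available yet; that point is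
    -- afterwards put in piece 0.
    have : ∀ m : ℕ, m ≤ n → x ≤ uniformPartition a b n m →
        x = a ∨ ∃ k < m, x ∈ Icc (uniformPartition a b n k) (uniformPartition a b n (k + 1)) := by
      intro m
      induction m with
      | zero =>
        intro _ h
        left
        exact le_antisymm (h.trans_eq hp.left) hx.1
      | succ m ih =>
        intro hm h
        rcases le_total x (uniformPartition a b n m) with hle | hle
        · rcases ih (by omega) hle with h | ⟨k, hk, h⟩
          · exact Or.inl h
          · exact Or.inr ⟨k, by omega, h⟩
        · exact Or.inr ⟨m, by omega, hle, h⟩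
    rw [mem_iUnion]
    rcases this n le_rfl (hx.2.trans_eq hp.right.symm) with rfl | ⟨k, hk, h⟩
    · exact ⟨⟨0, hn0⟩, x, ⟨hp.left.le, hp.left.symm.trans_le (hp.mono (by simp))⟩, rfl⟩
    · exact ⟨⟨k, hk⟩, x, h, rfl⟩
  · refine liminf_le_of_frequently_le' (Eventually.frequently ?_)
    filter_upwards [eventually_uniformPartition_succ_sub_lt a b hδ, eventually_gt_atTop 0]
      with n hn hn0
    have hp := isPartition_uniformPartition hab hn0.ne'
    set p := uniformPartition a b n with hpdef
    have hdiam : ∀ k : Fin n, Metric.ediam (A n k) ^ (2 : ℝ) ≤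
        ENNReal.ofReal ((1 + κ) * sqDist γ (p k) (p (k + 1))) := by
      intro k
      have hl := (hp.mem_Icc (k := k) (by omega)).1
      have hr := (hp.mem_Icc (k := k + 1) (by omega)).2
      have hna := h _ _ hl (hp.mono (Nat.le_succ k)) hr (hn k)
      have hκQ : 0 ≤ (1 + κ) * sqDist γ (p k) (p (k + 1)) :=
        mul_nonneg (by linarith) (sqDist_nonneg _ _ _)
      have key : ∀ x ∈ Icc (p k) (p (k + 1)), ∀ y ∈ Icc (p k) (p (k + 1)), x ≤ y →
          dist (γ x) (γ y) ≤ √((1 + κ) * sqDist γ (p k) (p (k + 1))) := fun x hx y hy hxy =>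
        Real.le_sqrt_of_sq_le (hna.le_of_subinterval (sqDist_nonneg γ) hx.1 hxy hy.2)
      have : Metric.ediam (A n k) ≤
          ENNReal.ofReal √((1 + κ) * sqDist γ (p k) (p (k + 1))) := by
        refine Metric.ediam_le ?_
        rintro _ ⟨x, hx, rfl⟩ _ ⟨y, hy, rfl⟩
        rw [edist_dist]
        apply ENNReal.ofReal_le_ofReal
        rcases le_total x y with hxy | hxy
        · exact key x hx y hy hxy
        · rw [dist_comm]
          exact key y hy x hx hxy
      refine (ENNReal.rpow_le_rpow this (by norm_num)).trans (le_of_eq ?_)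
      rw [ENNReal.rpow_ofNat, ← ENNReal.ofReal_pow (Real.sqrt_nonneg _), Real.sq_sqrt hκQ]
    calc ∑ k, Metric.ediam (A n k) ^ (2 : ℝ)
        ≤ ∑ k : Fin n, ENNReal.ofReal ((1 + κ) * sqDist γ (p k) (p (k + 1))) :=
          Finset.sum_le_sum fun k _ => hdiam k
      _ = ENNReal.ofReal ((1 + κ) * chainSum (sqDist γ) p n) := by
          rw [← ENNReal.ofReal_sum_of_nonneg
            (fun k _ => mul_nonneg (by linarith) (sqDist_nonneg _ _ _)), chainSum,
            Finset.mul_sum, Finset.sum_range]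
      _ ≤ _ := by
          apply ENNReal.ofReal_le_ofReal
          have := (abs_le.1 (he n p hp)).2
          have : 0 ≤ 1 + κ := by linarith
          gcongr
          linarith

/-- If the squared distance is nearly additive along an arc, with relative error tending to zero
with the length of the parameter interval, then a bound for the sums over all partitions of
the arc is a bound for its two-dimensional Hausdorff measure. -/
theorem abs_hausdorffMeasure_arc_sub_le (hab : a ≤ b) (hc : ContinuousOn γ (Icc a b))
    (hi : InjOn γ (Icc a b)) {e : ℝ}
    (h : ∀ κ > 0, ∃ δ > 0, ∀ s t, a ≤ s → s ≤ t → t ≤ b → t - s < δ →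
      NearlyAdditive (sqDist γ) κ s t)
    (he : ∀ n p, IsPartition p n a b → |chainSum (sqDist γ) p n - sqDist γ a b| ≤ e) :
    (μH[2] (γ '' Icc a b) : ℝ≥0∞) ≠ ∞ ∧
      |(μH[2] (γ '' Icc a b) : ℝ≥0∞).toReal - sqDist γ a b| ≤ e := by
  have hup : ∀ κ > 0, μH[2] (γ '' Icc a b) ≤ ENNReal.ofReal ((1 + κ) * (sqDist γ a b + e)) := by
    intro κ hκ
    obtain ⟨δ, hδ, hδ'⟩ := h κ hκ
    exact hausdorffMeasure_arc_le hab hc hκ.le hδ hδ' he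
  have hfin : (μH[2] (γ '' Icc a b) : ℝ≥0∞) ≠ ∞ :=
    ((hup 1 one_pos).trans_lt ENNReal.ofReal_lt_top).ne
  have he0 : 0 ≤ e := (abs_nonneg _).trans
    (he 1 _ (isPartition_uniformPartition hab one_ne_zero))
  have hQ := sqDist_nonneg γ a b
  set m := (μH[2] (γ '' Icc a b) : ℝ≥0∞).toReal with hm
  have hup' : ∀ κ > 0, m ≤ (1 + κ) * (sqDist γ a b + e) := fun κ hκ =>
    ENNReal.toReal_le_of_le_ofReal (by positivity) (hup κ hκ)
  -- The lower bound is applied to each piece of a fine partition and summed. The factors in `κ`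
  -- then tend to 1, whereas `e` is unaffected.
  have hlow : ∀ κ > 0, κ < 1 → (1 - κ) * (sqDist γ a b - e) ≤ (1 + κ) * m := by
    intro κ hκ hκ1
    obtain ⟨δ, hδ, hδ'⟩ := h κ hκ
    obtain ⟨n, hn, hn0⟩ := ((eventually_uniformPartition_succ_sub_lt a b hδ).and
      (eventually_gt_atTop 0)).exists
    have hp := isPartition_uniformPartition hab hn0.ne'
    set p := uniformPartition a b n with hpdef
    have h1 : ∀ k ∈ Finset.range n, ENNReal.ofReal ((1 - κ) * sqDist γ (p k) (p (k + 1))) ≤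
        ENNReal.ofReal (1 + κ) * μH[2] (γ '' Icc (p k) (p (k + 1))) := by
      intro k hk
      have hk' := Finset.mem_range.1 hk
      have hl := (hp.mem_Icc (k := k) (by omega)).1
      have hr := (hp.mem_Icc (k := k + 1) (by omega)).2
      have hsub := Icc_subset_Icc hl hr
      refine ofReal_mul_sqDist_le_hausdorffMeasure (hp.mono (Nat.le_succ k)) (hc.mono hsub)
        (hi.mono hsub) hκ.le fun s t hs hst ht => hδ' s t (hl.trans hs) hst (ht.trans hr) ?_
      exact (sub_le_sub ht hs).trans_lt (hn k)
    have h2 : ENNReal.ofReal ((1 - κ) * chainSum (sqDist γ) p n) ≤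
        ENNReal.ofReal (1 + κ) * μH[2] (γ '' Icc a b) := by
      calc ENNReal.ofReal ((1 - κ) * chainSum (sqDist γ) p n)
          = ∑ k ∈ Finset.range n, ENNReal.ofReal ((1 - κ) * sqDist γ (p k) (p (k + 1))) := by
            rw [chainSum, Finset.mul_sum, ENNReal.ofReal_sum_of_nonneg]
            exact fun k _ => mul_nonneg (by linarith) (sqDist_nonneg _ _ _)
        _ ≤ _ := Finset.sum_le_sum h1
        _ ≤ ENNReal.ofReal (1 + κ) * μH[2] (γ '' Icc (p 0) (p n)) := by
            rw [← Finset.mul_sum]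
            gcongr
            exact sum_hausdorffMeasure_arc hc hi hp.mono hp.left.ge n hp.right.le
        _ = _ := by rw [hp.left, hp.right]
    have h3 : (1 - κ) * chainSum (sqDist γ) p n ≤ (1 + κ) * m := by
      rw [← ENNReal.ofReal_toReal hfin, ← hm, ← ENNReal.ofReal_mul (by linarith)] at h2
      exact (ENNReal.ofReal_le_ofReal_iff
        (mul_nonneg (by linarith) ENNReal.toReal_nonneg)).1 h2
    have h4 := (abs_le.1 (he n p hp)).1
    nlinarith
  refine ⟨hfin, abs_le.2 ⟨?_, ?_⟩⟩
  · have t1 : Tendsto (fun κ : ℝ => (1 - κ) * (sqDist γ a b - e)) (𝓝[>] 0)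
        (𝓝 ((1 - 0) * (sqDist γ a b - e))) :=
      (Continuous.tendsto (by fun_prop) _).mono_left nhdsWithin_le_nhds
    have t2 : Tendsto (fun κ : ℝ => (1 + κ) * m) (𝓝[>] 0) (𝓝 ((1 + 0) * m)) :=
      (Continuous.tendsto (by fun_prop) _).mono_left nhdsWithin_le_nhds
    have := le_of_tendsto_of_tendsto t1 t2 (by
      filter_upwards [Ioo_mem_nhdsGT one_pos] with κ hκ using hlow κ hκ.1 hκ.2)
    linarith
  · have t2 : Tendsto (fun κ : ℝ => (1 + κ) * (sqDist γ a b + e)) (𝓝[>] 0)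
        (𝓝 ((1 + 0) * (sqDist γ a b + e))) :=
      (Continuous.tendsto (by fun_prop) _).mono_left nhdsWithin_le_nhds
    have := ge_of_tendsto t2 (by
      filter_upwards [self_mem_nhdsWithin] with κ hκ using hup' κ hκ)
    linarith

end Curve

/-! ### Horizontal homomorphisms and the horizontal mean value inequality -/

namespace Heis

theorem horizontal_sq_le (h : Heis) : h.x ^ 2 + h.y ^ 2 ≤ rho h ^ 2 :=
  (Real.sqrt_le_left (rho_nonneg h)).1 (le_max_left _ _)

theorem abs_x_le_rho (h : Heis) : |h.x| ≤ rho h :=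
  abs_le_of_sq_le_sq (by nlinarith [horizontal_sq_le h, sq_nonneg h.y]) (rho_nonneg h)

theorem abs_y_le_rho (h : Heis) : |h.y| ≤ rho h :=
  abs_le_of_sq_le_sq (by nlinarith [horizontal_sq_le h, sq_nonneg h.x]) (rho_nonneg h)

theorem abs_z_le_rho_sq (h : Heis) : |h.z| ≤ rho h ^ 2 :=
  (Real.sqrt_le_left (rho_nonneg h)).1 (le_max_right _ _)

theorem rho_le_of_sq_le {h : Heis} {r : ℝ} (hr : 0 ≤ r) (h1 : h.x ^ 2 + h.y ^ 2 ≤ r ^ 2)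
    (h2 : |h.z| ≤ r ^ 2) : rho h ≤ r :=
  max_le ((Real.sqrt_le_left hr).2 h1) ((Real.sqrt_le_left hr).2 h2)

theorem dist_eq_rho (A B : Heis) : dist A B = rho (A⁻¹ * B) := by rw [dist_comm, dist_def]

theorem dist_mul_right_self (A h : Heis) : dist (A * h) A = rho h := by
  rw [dist_def, inv_mul_cancel_left]

theorem dist_one_right (h : Heis) : dist h 1 = rho h := by simp [dist_def]

theorem rho_smul_horizontal (s x y : ℝ) : rho ⟨s * x, s * y, 0⟩ = |s| * rho ⟨x, y, 0⟩ := by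
  have e : (s * x) ^ 2 + (s * y) ^ 2 = s ^ 2 * (x ^ 2 + y ^ 2) := by ring
  simp only [rho, abs_zero, Real.sqrt_zero, e, Real.sqrt_mul (sq_nonneg s), Real.sqrt_sq_eq_abs]
  rw [max_eq_left (by positivity), max_eq_left (by positivity)]

section

variable {E : Type*} [NormedAddCommGroup E] [NormedSpace ℝ E]

namespace IsHorizontalHom

variable {L : Heis → E}

theorem map_one (hL : IsHorizontalHom L) : L 1 = 0 := by
  have := hL.map_mul 1 1
  rwa [mul_one, left_eq_add] at this

theorem map_inv (hL : IsHorizontalHom L) (A : Heis) : L A⁻¹ = -L A := by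
  rw [eq_neg_iff_add_eq_zero, ← hL.map_mul, inv_mul_cancel, hL.map_one]

theorem map_smul_horizontal (hL : IsHorizontalHom L) (t x y : ℝ) :
    L ⟨t * x, t * y, 0⟩ = t • L ⟨x, y, 0⟩ := by
  have pos : ∀ s : ℝ, 0 < s → L ⟨s * x, s * y, 0⟩ = s • L ⟨x, y, 0⟩ := fun s hs => by
    rw [← hL.map_dil s hs]
    simp [dil]
  rcases lt_trichotomy t 0 with ht | rfl | ht
  · have h1 := pos (-t) (by linarith)
    have h2 : (⟨t * x, t * y, 0⟩ : Heis) = (⟨-t * x, -t * y, 0⟩ : Heis)⁻¹ := by ext <;> simp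
    rw [h2, hL.map_inv, h1, neg_smul, neg_neg]
  · rw [zero_mul, zero_mul, zero_smul]
    exact hL.map_one
  · exact pos t ht

/-- Vertical elements are commutators of horizontal ones, and the target is abelian. -/
theorem map_vertical (hL : IsHorizontalHom L) (z : ℝ) : L ⟨0, 0, z⟩ = 0 := by
  have h : (⟨0, z / 4, 0⟩ : Heis) * ⟨1, 0, 0⟩ =
      (⟨1, 0, 0⟩ * ⟨0, z / 4, 0⟩) * (⟨0, 0, z⟩ : Heis) := by
    ext <;> simp
    ring
  have h' := congrArg L h
  rw [hL.map_mul, hL.map_mul, hL.map_mul, add_comm (L ⟨0, z / 4, 0⟩)] at h'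
  exact left_eq_add.1 h'

theorem apply_eq (hL : IsHorizontalHom L) (h : Heis) :
    L h = h.x • L ⟨1, 0, 0⟩ + h.y • L ⟨0, 1, 0⟩ := by
  have e : h = ⟨h.x * 1, h.x * 0, 0⟩ * ⟨h.y * 0, h.y * 1, 0⟩ *
      (⟨0, 0, h.z + 2 * (h.x * h.y)⟩ : Heis) := by
    ext <;> simp
  conv_lhs => rw [e]
  rw [hL.map_mul, hL.map_mul, hL.map_vertical, hL.map_smul_horizontal, hL.map_smul_horizontal,
    add_zero]

end IsHorizontalHom

namespace HasHorizontalDiffAt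

variable {f : Heis → E} {A : Heis} {L L' : Heis → E}

theorem hasDerivAt_zero (hf : HasHorizontalDiffAt f A L) (x y : ℝ) :
    HasDerivAt (fun t : ℝ => f (A * ⟨t * x, t * y, 0⟩)) (L ⟨x, y, 0⟩) 0 := by
  have ht : Tendsto (fun t : ℝ => (⟨t * x, t * y, 0⟩ : Heis)) (𝓝 0) (𝓝 1) := by
    rw [tendsto_iff_dist_tendsto_zero]
    simp only [dist_one_right, rho_smul_horizontal]
    have : Tendsto (fun t : ℝ => |t| * rho ⟨x, y, 0⟩) (𝓝 0) (𝓝 (|0| * rho ⟨x, y, 0⟩)) :=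
      Continuous.tendsto (by fun_prop) _
    simpa using this
  have h1 := hf.isLittleO.comp_tendsto ht
  rw [hasDerivAt_iff_isLittleO]
  have e1 : A * ⟨0 * x, 0 * y, 0⟩ = A := by
    rw [zero_mul, zero_mul]
    exact mul_one A
  refine (h1.congr_left fun t => ?_).trans_isBigO ?_
  · simp only [Function.comp_apply, sub_zero, e1, hf.isHorizontalHom.map_smul_horizontal]
  · refine Asymptotics.IsBigO.of_bound (rho ⟨x, y, 0⟩) (Eventually.of_forall fun t => ?_)
    simp only [Function.comp_apply, sub_zero, dist_one_right, rho_smul_horizontal, norm_mul,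
      Real.norm_eq_abs, abs_abs]
    rw [abs_of_nonneg (rho_nonneg _), mul_comm]

/-- A horizontal homomorphism is determined by its values on the two horizontal directions, and
these are derivatives of `f` along lines. -/
theorem unique (hf : HasHorizontalDiffAt f A L) (hf' : HasHorizontalDiffAt f A L') : L = L' := by
  funext h
  rw [hf.isHorizontalHom.apply_eq, hf'.isHorizontalHom.apply_eq,
    (hf.hasDerivAt_zero 1 0).unique (hf'.hasDerivAt_zero 1 0),
    (hf.hasDerivAt_zero 0 1).unique (hf'.hasDerivAt_zero 0 1)]

theorem comp_clm {G : Type*} [NormedAddCommGroup G] [NormedSpace ℝ G]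
    (hf : HasHorizontalDiffAt f A L) (φ : E →L[ℝ] G) :
    HasHorizontalDiffAt (fun P => φ (f P)) A (fun h => φ (L h)) where
  isHorizontalHom :=
    { map_mul := fun B C => by rw [hf.isHorizontalHom.map_mul, _root_.map_add]
      map_dil := fun t ht B => by rw [hf.isHorizontalHom.map_dil t ht, _root_.map_smul]
      continuous := φ.continuous.comp hf.isHorizontalHom.continuous }
  isLittleO := ((φ.isBigO_comp _ _).trans_isLittleO hf.isLittleO).congr_left fun h => by
    simp only [_root_.map_sub]

theorem derivX_eq {f : Heis → ℝ} {L : Heis → ℝ} (hf : HasHorizontalDiffAt f A L) :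
    derivX f A = L ⟨1, 0, 0⟩ := by
  have := (hf.hasDerivAt_zero 1 0).deriv
  simp only [mul_one, mul_zero] at this
  exact this

theorem derivY_eq {f : Heis → ℝ} {L : Heis → ℝ} (hf : HasHorizontalDiffAt f A L) :
    derivY f A = L ⟨0, 1, 0⟩ := by
  have := (hf.hasDerivAt_zero 0 1).deriv
  simp only [mul_one, mul_zero] at this
  exact this

end HasHorizontalDiffAt

/-- The points `(t x, t y, 0)` form a one-parameter subgroup, so a left translation moves the
derivative at `s` to the derivative at 0. -/
theorem hasDerivAt_horizontal_line {f : Heis → E} {D : Heis → Heis → E}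
    (hf : ∀ A, HasHorizontalDiffAt f A (D A)) (A : Heis) (x y s : ℝ) :
    HasDerivAt (fun t : ℝ => f (A * ⟨t * x, t * y, 0⟩))
      (D (A * ⟨s * x, s * y, 0⟩) ⟨x, y, 0⟩) s := by
  have h : HasDerivAt (fun t : ℝ => f (A * ⟨s * x, s * y, 0⟩ * ⟨t * x, t * y, 0⟩))
      (D (A * ⟨s * x, s * y, 0⟩) ⟨x, y, 0⟩) (s - s) := by
    rw [sub_self]
    exact (hf _).hasDerivAt_zero x y
  have h' := h.comp_sub_const s s
  refine h'.congr_of_eventuallyEq (Eventually.of_forall fun t => ?_)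
  change f _ = f _
  congr 1
  ext <;> simp <;> ring

/-- Mean value inequality along a horizontal segment. -/
theorem norm_sub_sub_le_of_segment {f : Heis → E} {D : Heis → Heis → E}
    (hf : ∀ A, HasHorizontalDiffAt f A (D A)) {A : Heis} {L : Heis → E}
    {R c : ℝ} (hc : ∀ B, dist B A ≤ R → NormLE (fun h => D B h - L h) c) (B : Heis) (x y : ℝ)
    (hB : dist B A + rho ⟨x, y, 0⟩ ≤ R) :
    ‖f (B * ⟨x, y, 0⟩) - f B - L ⟨x, y, 0⟩‖ ≤ c * rho ⟨x, y, 0⟩ := by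
  have key := Convex.norm_image_sub_le_of_norm_hasDerivWithin_le (𝕜 := ℝ)
    (f := fun s : ℝ => f (B * ⟨s * x, s * y, 0⟩) - s • L ⟨x, y, 0⟩)
    (f' := fun s : ℝ => D (B * ⟨s * x, s * y, 0⟩) ⟨x, y, 0⟩ - (1 : ℝ) • L ⟨x, y, 0⟩)
    (s := Icc 0 1) (x := 0) (y := 1) (C := c * rho ⟨x, y, 0⟩)
    (fun s _ => ((hasDerivAt_horizontal_line hf B x y s).sub
      ((hasDerivAt_id s).smul_const _)).hasDerivWithinAt)
    (fun s hs => by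
      rw [one_smul]
      refine hc _ ?_ _
      refine (dist_triangle _ B _).trans (le_trans ?_ hB)
      rw [dist_mul_right_self, rho_smul_horizontal, abs_of_nonneg hs.1, add_comm]
      have := rho_nonneg ⟨x, y, 0⟩
      nlinarith [hs.2])
    (convex_Icc 0 1) (left_mem_Icc.2 zero_le_one) (right_mem_Icc.2 zero_le_one)
  have e0 : B * ⟨0 * x, 0 * y, 0⟩ = B := by
    rw [zero_mul, zero_mul]
    exact mul_one B
  simp only [one_mul, one_smul, e0, zero_smul, sub_zero, norm_one, mul_one] at key
  rwa [sub_right_comm] at key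

/-- Mean value inequality on the Heisenberg group: every `h` is the end of a horizontal path of
five segments whose total length is at most `3 ρ_∞(h)`. -/
theorem norm_sub_sub_le {f : Heis → E} {D : Heis → Heis → E}
    (hf : ∀ A, HasHorizontalDiffAt f A (D A)) {A h : Heis} {c : ℝ} (hc0 : 0 ≤ c)
    (hc : ∀ B, dist B A ≤ 3 * rho h → NormLE (fun h => D B h - D A h) c) :
    ‖f (A * h) - f A - D A h‖ ≤ 3 * c * rho h := by
  have hL := (hf A).isHorizontalHom
  have hρ := rho_nonneg h
  set r := rho h with hr
  -- The commutator of `(a, 0, 0)` and `(0, b, 0)` is `(0, 0, -4ab)`. Its four sides have length at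
  -- most `r / 2` each; with the segment to `(h.x, h.y, 0)`, of length at most `r`, the total is at
  -- most `3r`.
  obtain ⟨a, b, ha, hb, hab⟩ : ∃ a b : ℝ, |a| ≤ r / 2 ∧ |b| ≤ r / 2 ∧ -4 * a * b = h.z := by
    have hs : √|h.z| ≤ r := le_max_right _ _
    have h0 := Real.sqrt_nonneg |h.z|
    have hsq := Real.mul_self_sqrt (abs_nonneg h.z)
    rcases le_total 0 h.z with hz | hz
    · refine ⟨√|h.z| / 2, -(√|h.z| / 2), ?_, ?_, ?_⟩
      · rw [abs_of_nonneg (by positivity)]; linarith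
      · rw [abs_neg, abs_of_nonneg (by positivity)]; linarith
      · rw [abs_of_nonneg hz] at hsq ⊢; linarith
    · refine ⟨√|h.z| / 2, √|h.z| / 2, ?_, ?_, ?_⟩
      · rw [abs_of_nonneg (by positivity)]; linarith
      · rw [abs_of_nonneg (by positivity)]; linarith
      · rw [abs_of_nonpos hz] at hsq ⊢; linarith
  have n1 : rho ⟨h.x, h.y, 0⟩ ≤ r :=
    rho_le_of_sq_le hρ (horizontal_sq_le h) (by rw [abs_zero]; positivity)
  have nx : ∀ a : ℝ, |a| ≤ r / 2 → rho ⟨a, 0, 0⟩ ≤ r / 2 := fun a ha =>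
    rho_le_of_sq_le (by linarith)
      (by simp only [ne_eq, OfNat.ofNat_ne_zero, not_false_eq_true, zero_pow, add_zero]
          exact sq_le_sq' (by linarith [(abs_le.1 ha).1]) (abs_le.1 ha).2)
      (by rw [abs_zero]; positivity)
  have ny : ∀ a : ℝ, |a| ≤ r / 2 → rho ⟨0, a, 0⟩ ≤ r / 2 := fun a ha =>
    rho_le_of_sq_le (by linarith)
      (by simp only [ne_eq, OfNat.ofNat_ne_zero, not_false_eq_true, zero_pow, zero_add]
          exact sq_le_sq' (by linarith [(abs_le.1 ha).1]) (abs_le.1 ha).2)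
      (by rw [abs_zero]; positivity)
  have n2 := nx a ha
  have n3 := ny b hb
  have n4 := nx (-a) (by rwa [abs_neg])
  have n5 := ny (-b) (by rwa [abs_neg])
  have step : ∀ (B v : Heis), dist (B * v) A ≤ dist B A + rho v := fun B v => by
    have := dist_triangle (B * v) B A
    rw [dist_mul_right_self] at this
    linarith
  set v₁ : Heis := ⟨h.x, h.y, 0⟩
  set v₂ : Heis := ⟨a, 0, 0⟩
  set v₃ : Heis := ⟨0, b, 0⟩
  set v₄ : Heis := ⟨-a, 0, 0⟩
  set v₅ : Heis := ⟨0, -b, 0⟩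
  have d1 := step A v₁
  rw [dist_self] at d1
  have d2 := step (A * v₁) v₂
  have d3 := step (A * v₁ * v₂) v₃
  have d4 := step (A * v₁ * v₂ * v₃) v₄
  have s1 := norm_sub_sub_le_of_segment hf hc A h.x h.y (by rw [dist_self]; linarith)
  have s2 := norm_sub_sub_le_of_segment hf hc (A * v₁) a 0 (by linarith)
  have s3 := norm_sub_sub_le_of_segment hf hc (A * v₁ * v₂) 0 b (by linarith)
  have s4 := norm_sub_sub_le_of_segment hf hc (A * v₁ * v₂ * v₃) (-a) 0 (by linarith)
  have s5 := norm_sub_sub_le_of_segment hf hc (A * v₁ * v₂ * v₃ * v₄) 0 (-b) (by linarith)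
  have hend : h = v₁ * v₂ * v₃ * v₄ * v₅ := by
    ext
    · simp [v₁, v₂, v₃, v₄, v₅]
    · simp [v₁, v₂, v₃, v₄, v₅]
    · simp [v₁, v₂, v₃, v₄, v₅]
      linarith
  have e : f (A * h) - f A - D A h =
      (f (A * v₁) - f A - D A v₁) + (f (A * v₁ * v₂) - f (A * v₁) - D A v₂) +
      (f (A * v₁ * v₂ * v₃) - f (A * v₁ * v₂) - D A v₃) +
      (f (A * v₁ * v₂ * v₃ * v₄) - f (A * v₁ * v₂ * v₃) - D A v₄) +
      (f (A * v₁ * v₂ * v₃ * v₄ * v₅) - f (A * v₁ * v₂ * v₃ * v₄) - D A v₅) := by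
    conv_lhs => rw [hend]
    simp only [hL.map_mul, mul_assoc]
    abel
  rw [e]
  have t1 := mul_le_mul_of_nonneg_left n1 hc0
  have t2 := mul_le_mul_of_nonneg_left n2 hc0
  have t3 := mul_le_mul_of_nonneg_left n3 hc0
  have t4 := mul_le_mul_of_nonneg_left n4 hc0
  have t5 := mul_le_mul_of_nonneg_left n5 hc0
  refine (norm_add_le_of_le (norm_add_le_of_le (norm_add_le_of_le (norm_add_le_of_le
    (s1.trans t1) (s2.trans t2)) (s3.trans t3)) (s4.trans t4)) (s5.trans t5)).trans
    (le_of_eq ?_)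
  ring

end

end Heis

/-! ### Continuity of coordinates and first-order estimates on level sets -/

namespace Heis

theorem continuous_x : Continuous (fun A : Heis => A.x) :=
  (LipschitzWith.mk_one fun A B => by
    have h := abs_x_le_rho (B⁻¹ * A)
    rw [← dist_def, mul_x, inv_x, neg_add_eq_sub] at h
    rwa [Real.dist_eq]).continuous

theorem continuous_y : Continuous (fun A : Heis => A.y) :=
  (LipschitzWith.mk_one fun A B => by
    have h := abs_y_le_rho (B⁻¹ * A)
    rw [← dist_def, mul_y, inv_y, neg_add_eq_sub] at h
    rwa [Real.dist_eq]).continuous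

theorem continuous_z : Continuous (fun A : Heis => A.z) := by
  rw [continuous_iff_continuousAt]
  intro A
  rw [ContinuousAt, tendsto_iff_dist_tendsto_zero]
  have hlim : Tendsto (fun B : Heis => dist B A ^ 2 + 2 * (|A.x| + |A.y|) * dist B A) (𝓝 A)
      (𝓝 (dist A A ^ 2 + 2 * (|A.x| + |A.y|) * dist A A)) :=
    Continuous.tendsto (by fun_prop) A
  rw [dist_self] at hlim
  norm_num at hlim
  refine squeeze_zero (fun _ => dist_nonneg) (fun B => ?_) hlim
  have hx := abs_x_le_rho (A⁻¹ * B)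
  have hy := abs_y_le_rho (A⁻¹ * B)
  have hz := abs_z_le_rho_sq (A⁻¹ * B)
  rw [← dist_def] at hx hy hz
  have e : B.z - A.z = (A⁻¹ * B).z + 2 * ((A⁻¹ * B).x * A.y) - 2 * (A.x * (A⁻¹ * B).y) := by
    simp
    ring
  have h1 : |(A⁻¹ * B).x * A.y| ≤ |A.y| * dist B A := by
    rw [abs_mul, mul_comm]; gcongr
  have h2 : |A.x * (A⁻¹ * B).y| ≤ |A.x| * dist B A := by
    rw [abs_mul]; gcongr
  rw [Real.dist_eq, e]
  rw [abs_le] at h1 h2 hz ⊢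
  constructor <;> nlinarith [h1.1, h1.2, h2.1, h2.2, hz.1, hz.2]

section

variable {E : Type*} [NormedAddCommGroup E] [NormedSpace ℝ E] {f : Heis → E}
  {D : Heis → Heis → E}

theorem rho_e₁ : rho ⟨1, 0, 0⟩ = 1 := by simp [rho]

theorem rho_e₂ : rho ⟨0, 1, 0⟩ = 1 := by simp [rho]

theorem IsHorizontalHom.normLE_sub {L L' : Heis → E} (hL : IsHorizontalHom L)
    (hL' : IsHorizontalHom L') {c : ℝ} (h1 : ‖L ⟨1, 0, 0⟩ - L' ⟨1, 0, 0⟩‖ ≤ c)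
    (h2 : ‖L ⟨0, 1, 0⟩ - L' ⟨0, 1, 0⟩‖ ≤ c) : NormLE (fun h => L h - L' h) (2 * c) := by
  intro h
  have e : L h - L' h = h.x • (L ⟨1, 0, 0⟩ - L' ⟨1, 0, 0⟩) +
      h.y • (L ⟨0, 1, 0⟩ - L' ⟨0, 1, 0⟩) := by
    rw [hL.apply_eq, hL'.apply_eq]
    module
  change ‖L h - L' h‖ ≤ _
  rw [e]
  refine (norm_add_le _ _).trans ?_
  rw [norm_smul, norm_smul, Real.norm_eq_abs, Real.norm_eq_abs]
  have a1 := mul_le_mul (abs_x_le_rho h) h1 (norm_nonneg _) (rho_nonneg h)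
  have a2 := mul_le_mul (abs_y_le_rho h) h2 (norm_nonneg _) (rho_nonneg h)
  linarith

theorem continuous_horizontalDiff_apply {E : Type*} [NormedAddCommGroup E] {D : Heis → Heis → E}
    (hD : ∀ A, ∀ ε > 0, ∃ δ > 0, ∀ B, dist A B < δ → NormLE (fun h => D B h - D A h) ε)
    {v : Heis} (hv : rho v = 1) : Continuous fun A => D A v := by
  rw [Metric.continuous_iff]
  intro A ε hε
  obtain ⟨δ, hδ, h⟩ := hD A (ε / 2) (by positivity)
  refine ⟨δ, hδ, fun B hB => ?_⟩
  have := h B (by rwa [dist_comm]) v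
  rw [hv] at this
  rw [dist_eq_norm]
  exact this.trans_lt (by linarith)

/-- Only `A` is confined to `K`: the horizontal paths of the mean value inequality leave the arc. By
linearity it is enough to treat the two basis directions. -/
theorem exists_normLE_of_isCompact (hf : ∀ A, HasHorizontalDiffAt f A (D A))
    (hD : ∀ A, ∀ ε > 0, ∃ δ > 0, ∀ B, dist A B < δ → NormLE (fun h => D B h - D A h) ε)
    {K : Set Heis} (hK : IsCompact K) {ε : ℝ} (hε : 0 < ε) :
    ∃ δ > 0, ∀ A ∈ K, ∀ B, dist A B < δ → NormLE (fun h => D B h - D A h) ε := by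
  have key : ∀ v : Heis, rho v = 1 →
      ∃ δ > 0, ∀ A ∈ K, ∀ B, dist A B < δ → ‖D B v - D A v‖ ≤ ε / 2 := by
    intro v hv
    have h := hK.uniformContinuousAt_of_continuousAt (fun A => D A v)
      (fun A _ => (continuous_horizontalDiff_apply hD hv).continuousAt)
      (Metric.dist_mem_uniformity (half_pos hε))
    obtain ⟨δ, hδ, h'⟩ := Metric.mem_uniformity_dist.1 h
    refine ⟨δ, hδ, fun A hA B hAB => ?_⟩
    rw [← dist_eq_norm, dist_comm]
    exact le_of_lt (h' hAB hA)
  obtain ⟨δ₁, hδ₁, h1⟩ := key _ rho_e₁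
  obtain ⟨δ₂, hδ₂, h2⟩ := key _ rho_e₂
  refine ⟨min δ₁ δ₂, lt_min hδ₁ hδ₂, fun A hA B hAB => ?_⟩
  have := (hf B).isHorizontalHom.normLE_sub (hf A).isHorizontalHom
    (h1 A hA B (hAB.trans_le (min_le_left _ _))) (h2 A hA B (hAB.trans_le (min_le_right _ _)))
  rwa [mul_div_cancel₀ _ two_ne_zero] at this

/-- On a level set the horizontal differential at `A` is `o(d_∞(A, B))` in the direction of `B`,
uniformly for `A` in a compact set. -/
theorem exists_norm_apply_le_of_isCompact (hf : ∀ A, HasHorizontalDiffAt f A (D A))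
    (hD : ∀ A, ∀ ε > 0, ∃ δ > 0, ∀ B, dist A B < δ → NormLE (fun h => D B h - D A h) ε)
    {K : Set Heis} (hK : IsCompact K) {ε : ℝ} (hε : 0 < ε) :
    ∃ δ > 0, ∀ A ∈ K, ∀ B, f A = f B → dist A B < δ → ‖D A (A⁻¹ * B)‖ ≤ ε * dist A B := by
  obtain ⟨δ, hδ, h⟩ := exists_normLE_of_isCompact hf hD hK (ε := ε / 3) (by positivity)
  -- The horizontal path stays within three times the distance, so `δ / 4` keeps it in the ball of
  -- radius `δ`; likewise `ε / 3` cancels the factor 3 of the mean value inequality.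
  refine ⟨δ / 4, by positivity, fun A hA B hAB hd => ?_⟩
  have := norm_sub_sub_le hf (A := A) (h := A⁻¹ * B) (c := ε / 3) (by positivity)
    (fun B' hB' => h A hA B' (by rw [← dist_eq_rho] at hB'; rw [dist_comm]; linarith))
  rw [mul_inv_cancel_left, hAB, sub_self, zero_sub, norm_neg, ← dist_eq_rho] at this
  linarith

/-- On a level set of a function whose horizontal derivatives have modulus of continuity `ω`, the
horizontal differential at `A` in the direction of `B` is controlled by `ω`. -/
theorem norm_apply_le_of_modulus (hf : ∀ A, HasHorizontalDiffAt f A (D A)) {ω : ℝ → ℝ}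
    (hω : MonotoneOn ω (Ici 0)) (hω0 : ∀ r, 0 ≤ r → 0 ≤ ω r)
    (h : ∀ A B, NormLE (fun h => D B h - D A h) (ω (dist A B))) {A B : Heis} (hAB : f A = f B) :
    ‖D A (A⁻¹ * B)‖ ≤ 3 * ω (3 * dist A B) * dist A B := by
  have hd : 0 ≤ dist A B := dist_nonneg
  have := norm_sub_sub_le hf (A := A) (h := A⁻¹ * B) (c := ω (3 * dist A B))
    (hω0 _ (by positivity)) (fun B' hB' P => (h A B' P).trans (by
      have := rho_nonneg P
      gcongr
      refine hω (mem_Ici.2 dist_nonneg) (mem_Ici.2 (by positivity)) ?_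
      rw [← dist_eq_rho] at hB'
      rwa [dist_comm A B']))
  rwa [mul_inv_cancel_left, hAB, sub_self, zero_sub, norm_neg, ← dist_eq_rho] at this

end

/-! ### Linear algebra of horizontal homomorphisms into the plane -/

/-- The determinant of a horizontal homomorphism into the plane. -/
noncomputable def hdet (L : Heis → EuclideanSpace ℝ (Fin 2)) : ℝ :=
  L ⟨1, 0, 0⟩ 0 * L ⟨0, 1, 0⟩ 1 - L ⟨1, 0, 0⟩ 1 * L ⟨0, 1, 0⟩ 0

section Plane

variable {L : Heis → EuclideanSpace ℝ (Fin 2)}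

theorem IsHorizontalHom.apply_coord (hL : IsHorizontalHom L) (h : Heis) (i : Fin 2) :
    L h i = h.x * L ⟨1, 0, 0⟩ i + h.y * L ⟨0, 1, 0⟩ i := by
  conv_lhs => rw [hL.apply_eq]
  simp

/-- Multiplicativity of the determinant; it will turn the cross product of displacements into
products of components of `L`. -/
theorem IsHorizontalHom.hdet_mul_cross (hL : IsHorizontalHom L) (h k : Heis) :
    hdet L * (h.x * k.y - k.x * h.y) = L h 0 * L k 1 - L h 1 * L k 0 := by
  rw [hL.apply_coord h, hL.apply_coord h, hL.apply_coord k, hL.apply_coord k, hdet]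
  ring

theorem IsHorizontalHom.hdet_ne_zero (hL : IsHorizontalHom L) (hs : Function.Surjective L) :
    hdet L ≠ 0 := by
  obtain ⟨h, hh⟩ := hs !₂[1, 0]
  obtain ⟨k, hk⟩ := hs !₂[0, 1]
  have := hL.hdet_mul_cross h k
  rw [hh, hk] at this
  intro h0
  simp [h0] at this

/-- Cramer's rule. -/
theorem IsHorizontalHom.abs_x_le (hL : IsHorizontalHom L) (h0 : hdet L ≠ 0) (h : Heis) :
    |h.x| ≤ |hdet L|⁻¹ * (2 * ‖L ⟨0, 1, 0⟩‖) * ‖L h‖ := by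
  have e : h.x = (hdet L)⁻¹ * (L h 0 * L ⟨0, 1, 0⟩ 1 - L h 1 * L ⟨0, 1, 0⟩ 0) := by
    rw [← hL.hdet_mul_cross h ⟨0, 1, 0⟩]
    field_simp
    ring
  have n := fun (v : EuclideanSpace ℝ (Fin 2)) i => PiLp.norm_apply_le v i
  rw [e, abs_mul, abs_inv, mul_assoc]
  gcongr
  refine (abs_sub _ _).trans ?_
  rw [abs_mul, abs_mul]
  have a := mul_le_mul (n (L h) 0) (n (L ⟨0, 1, 0⟩) 1) (norm_nonneg _) (norm_nonneg _)
  have b := mul_le_mul (n (L h) 1) (n (L ⟨0, 1, 0⟩) 0) (norm_nonneg _) (norm_nonneg _)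
  simp only [Real.norm_eq_abs] at a b
  linarith

theorem IsHorizontalHom.abs_y_le (hL : IsHorizontalHom L) (h0 : hdet L ≠ 0) (h : Heis) :
    |h.y| ≤ |hdet L|⁻¹ * (2 * ‖L ⟨1, 0, 0⟩‖) * ‖L h‖ := by
  have e : h.y = (hdet L)⁻¹ * (L ⟨1, 0, 0⟩ 0 * L h 1 - L ⟨1, 0, 0⟩ 1 * L h 0) := by
    rw [← hL.hdet_mul_cross ⟨1, 0, 0⟩ h]
    field_simp
    ring
  have n := fun (v : EuclideanSpace ℝ (Fin 2)) i => PiLp.norm_apply_le v i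
  rw [e, abs_mul, abs_inv, mul_assoc]
  gcongr
  refine (abs_sub _ _).trans ?_
  rw [abs_mul, abs_mul]
  have a := mul_le_mul (n (L ⟨1, 0, 0⟩) 0) (n (L h) 1) (norm_nonneg _) (norm_nonneg _)
  have b := mul_le_mul (n (L ⟨1, 0, 0⟩) 1) (n (L h) 0) (norm_nonneg _) (norm_nonneg _)
  simp only [Real.norm_eq_abs] at a b
  linarith

end Plane

/-! ### Vertical curves at small scales -/

section VerticalCurve

variable {F : Heis → EuclideanSpace ℝ (Fin 2)} {D : Heis → Heis → EuclideanSpace ℝ (Fin 2)}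
  {γ : ℝ → Heis}

theorem IsVerticalCurve.exists_dist_lt (hγ : IsVerticalCurve F γ) {η : ℝ} (hη : 0 < η) :
    ∃ δ > 0, ∀ s ∈ Icc (0 : ℝ) 1, ∀ t ∈ Icc (0 : ℝ) 1, |s - t| < δ → dist (γ s) (γ t) < η := by
  have h := isCompact_Icc.uniformContinuousOn_of_continuous hγ.continuousOn
  obtain ⟨δ, hδ, h'⟩ := Metric.uniformContinuousOn_iff.1 h η hη
  exact ⟨δ, hδ, fun s hs t ht hst => h' s hs t ht hst⟩

/-- Points of a simple arc that are close in the metric have close parameters. -/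
theorem IsVerticalCurve.exists_param_lt (hγ : IsVerticalCurve F γ) {η : ℝ} (hη : 0 < η) :
    ∃ δ > 0, ∀ s ∈ Icc (0 : ℝ) 1, ∀ t ∈ Icc (0 : ℝ) 1, dist (γ s) (γ t) < δ → |s - t| < η := by
  set K : Set (ℝ × ℝ) := (Icc 0 1 ×ˢ Icc 0 1) ∩ {p | η ≤ |p.1 - p.2|} with hK
  have hKc : IsCompact K :=
    (isCompact_Icc.prod isCompact_Icc).inter_right
      (isClosed_le continuous_const (by fun_prop))
  have hcont : ContinuousOn (fun p : ℝ × ℝ => dist (γ p.1) (γ p.2)) K := by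
    exact continuous_dist.comp_continuousOn
      ((hγ.continuousOn.comp continuousOn_fst fun p hp => hp.1.1).prodMk
        (hγ.continuousOn.comp continuousOn_snd fun p hp => hp.1.2))
  rcases K.eq_empty_or_nonempty with hKe | hKn
  · refine ⟨1, one_pos, fun s hs t ht _ => ?_⟩
    by_contra! hcon
    have : (s, t) ∈ K := ⟨⟨hs, ht⟩, hcon⟩
    rw [hKe] at this
    exact this
  · obtain ⟨p, hp, hmin⟩ := hKc.exists_isMinOn hKn hcont
    refine ⟨dist (γ p.1) (γ p.2), ?_, fun s hs t ht hd => ?_⟩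
    · refine dist_pos.2 fun heq => ?_
      have := hγ.injOn hp.1.1 hp.1.2 heq
      have h2 : η ≤ |p.1 - p.2| := hp.2
      rw [this, sub_self, abs_zero] at h2
      linarith
    · by_contra! hcon
      have : dist (γ p.1) (γ p.2) ≤ dist (γ s) (γ t) :=
        hmin (show (s, t) ∈ K from ⟨⟨hs, ht⟩, hcon⟩)
      linarith

theorem IsVerticalCurve.isCompact_image (hγ : IsVerticalCurve F γ) :
    IsCompact (γ '' Icc 0 1) := isCompact_Icc.image_of_continuousOn hγ.continuousOn

theorem IsVerticalCurve.hdet_ne_zero (hγ : IsVerticalCurve F γ)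
    (hF : ∀ A, HasHorizontalDiffAt F A (D A)) {t : ℝ} (ht : t ∈ Icc (0 : ℝ) 1) :
    hdet (D (γ t)) ≠ 0 := by
  obtain ⟨L, hL, hs⟩ := hγ.surjective t ht
  rw [(hF (γ t)).unique hL]
  exact hL.isHorizontalHom.hdet_ne_zero hs

theorem IsVerticalCurve.exists_bound (hγ : IsVerticalCurve F γ)
    (hF : ∀ A, HasHorizontalDiffAt F A (D A))
    (hD : ∀ A, ∀ ε > 0, ∃ δ > 0, ∀ B, dist A B < δ → NormLE (fun h => D B h - D A h) ε) :
    ∃ C > 0, ∀ t ∈ Icc (0 : ℝ) 1, |hdet (D (γ t))|⁻¹ ≤ C ∧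
      ∀ h, |h.x| ≤ C * ‖D (γ t) h‖ ∧ |h.y| ≤ C * ‖D (γ t) h‖ := by
  have c1 := continuous_horizontalDiff_apply hD rho_e₁
  have c2 := continuous_horizontalDiff_apply hD rho_e₂
  have cdet : Continuous fun A => hdet (D A) := by
    unfold hdet
    have k1 : ∀ i, Continuous fun A => D A ⟨1, 0, 0⟩ i := fun i =>
      (EuclideanSpace.proj (𝕜 := ℝ) i).continuous.comp c1
    have k2 : ∀ i, Continuous fun A => D A ⟨0, 1, 0⟩ i := fun i =>
      (EuclideanSpace.proj (𝕜 := ℝ) i).continuous.comp c2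
    exact ((k1 0).mul (k2 1)).sub ((k1 1).mul (k2 0))
  obtain ⟨C₁, h1⟩ := hγ.isCompact_image.exists_bound_of_continuousOn c1.continuousOn
  obtain ⟨C₂, h2⟩ := hγ.isCompact_image.exists_bound_of_continuousOn c2.continuousOn
  obtain ⟨C₃, h3⟩ := hγ.isCompact_image.exists_bound_of_continuousOn (f := fun A => (hdet (D A))⁻¹)
    (cdet.continuousOn.inv₀ (by
      rintro _ ⟨t, ht, rfl⟩
      exact hγ.hdet_ne_zero hF ht))
  set M := max 1 (max C₁ C₂) with hM
  have hM1 : 1 ≤ M := le_max_left _ _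
  have hMC₁ : C₁ ≤ M := (le_max_left _ _).trans (le_max_right _ _)
  have hMC₂ : C₂ ≤ M := (le_max_right _ _).trans (le_max_right _ _)
  refine ⟨max 1 C₃ * (2 * M), by positivity, fun t ht => ?_⟩
  have hmem : γ t ∈ γ '' Icc 0 1 := mem_image_of_mem _ ht
  have b1 := (h1 _ hmem).trans hMC₁
  have b2 := (h2 _ hmem).trans hMC₂
  have b3 := (h3 _ hmem).trans (le_max_right 1 C₃)
  rw [Real.norm_eq_abs, abs_inv] at b3
  have h0 := hγ.hdet_ne_zero hF ht
  have hL := (hF (γ t)).isHorizontalHom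
  refine ⟨b3.trans (le_mul_of_one_le_right (by positivity) (by linarith)), fun h => ⟨?_, ?_⟩⟩
  · refine (hL.abs_x_le h0 h).trans ?_
    gcongr
  · refine (hL.abs_y_le h0 h).trans ?_
    gcongr

theorem IsVerticalCurve.exists_norm_apply_le (hγ : IsVerticalCurve F γ)
    (hF : ∀ A, HasHorizontalDiffAt F A (D A))
    (hD : ∀ A, ∀ ε > 0, ∃ δ > 0, ∀ B, dist A B < δ → NormLE (fun h => D B h - D A h) ε)
    {ε : ℝ} (hε : 0 < ε) :
    ∃ δ > 0, ∀ s ∈ Icc (0 : ℝ) 1, ∀ t ∈ Icc (0 : ℝ) 1, |s - t| < δ →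
      ‖D (γ s) ((γ s)⁻¹ * γ t)‖ ≤ ε * dist (γ s) (γ t) := by
  obtain ⟨η, hη, h⟩ := exists_norm_apply_le_of_isCompact hF hD hγ.isCompact_image hε
  obtain ⟨δ, hδ, h'⟩ := hγ.exists_dist_lt hη
  refine ⟨δ, hδ, fun s hs t ht hst => h _ (mem_image_of_mem _ hs) _ ?_ (h' s hs t ht hst)⟩
  rw [hγ.mem_level s hs, hγ.mem_level t ht]

/-- A vertical curve is nearly vertical at small scales: the squared distance is the absolute
value of the vertical coordinate. -/
theorem IsVerticalCurve.exists_sqDist_eq_abs (hγ : IsVerticalCurve F γ)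
    (hF : ∀ A, HasHorizontalDiffAt F A (D A))
    (hD : ∀ A, ∀ ε > 0, ∃ δ > 0, ∀ B, dist A B < δ → NormLE (fun h => D B h - D A h) ε) :
    ∃ δ > 0, ∀ s ∈ Icc (0 : ℝ) 1, ∀ t ∈ Icc (0 : ℝ) 1, |s - t| < δ →
      sqDist γ s t = |((γ s)⁻¹ * γ t).z| := by
  obtain ⟨C, hC, hb⟩ := hγ.exists_bound hF hD
  -- With this `ε` both horizontal coordinates are at most half the distance, so `x² + y²` is at
  -- most half its square and the maximum in `rho` is attained by the vertical term.
  obtain ⟨δ, hδ, h⟩ := hγ.exists_norm_apply_le hF hD (ε := 1 / (2 * C)) (by positivity)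
  refine ⟨δ, hδ, fun s hs t ht hst => ?_⟩
  have h1 := h s hs t ht hst
  obtain ⟨hx, hy⟩ := (hb s hs).2 ((γ s)⁻¹ * γ t)
  have h2 : C * ‖D (γ s) ((γ s)⁻¹ * γ t)‖ ≤ dist (γ s) (γ t) / 2 := by
    calc _ ≤ C * (1 / (2 * C) * dist (γ s) (γ t)) := by gcongr
      _ = _ := by field_simp
  rw [sqDist]
  rw [dist_eq_rho] at h2 ⊢
  set g := (γ s)⁻¹ * γ t
  have hρ := rho_nonneg g
  refine le_antisymm ?_ (abs_z_le_rho_sq g)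
  have hsqx := sq_le_sq' (by linarith [(abs_le.1 (hx.trans h2)).1]) (abs_le.1 (hx.trans h2)).2
  have hsqy := sq_le_sq' (by linarith [(abs_le.1 (hy.trans h2)).1]) (abs_le.1 (hy.trans h2)).2
  have hsum : g.x ^ 2 + g.y ^ 2 ≤ rho g ^ 2 / 2 := by nlinarith
  rcases le_total (√(g.x ^ 2 + g.y ^ 2)) √|g.z| with hle | hle
  · rw [rho, max_eq_right hle, Real.sq_sqrt (abs_nonneg _)]
  · have : rho g ^ 2 = g.x ^ 2 + g.y ^ 2 := by
      rw [rho, max_eq_left hle, Real.sq_sqrt (by positivity)]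
    have := abs_nonneg g.z
    nlinarith

/-- The pairs `s < t` with `t - s < δ` form a convex set, on which the vertical coordinate is
continuous and, by injectivity of `γ`, never zero. Removing the absolute value makes the defect of
additivity computable. -/
theorem IsVerticalCurve.exists_sign (hγ : IsVerticalCurve F γ)
    (hF : ∀ A, HasHorizontalDiffAt F A (D A))
    (hD : ∀ A, ∀ ε > 0, ∃ δ > 0, ∀ B, dist A B < δ → NormLE (fun h => D B h - D A h) ε) :
    ∃ δ > 0, ∃ σ : ℝ, |σ| = 1 ∧ ∀ s t, 0 ≤ s → s ≤ t → t ≤ 1 → t - s < δ →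
      sqDist γ s t = σ * ((γ s)⁻¹ * γ t).z := by
  obtain ⟨δ, hδ, h⟩ := hγ.exists_sqDist_eq_abs hF hD
  set U : Set (ℝ × ℝ) := {p | 0 ≤ p.1 ∧ p.1 < p.2 ∧ p.2 ≤ 1 ∧ p.2 - p.1 < δ} with hU
  have hUc : Convex ℝ U := by
    rintro ⟨a, b⟩ ⟨h1, h2, h3, h4⟩ ⟨c, d⟩ ⟨k1, k2, k3, k4⟩ u v hu hv huv
    simp only [hU, mem_ofPred_eq, Prod.smul_mk, Prod.mk_add_mk, smul_eq_mul] at *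
    obtain rfl : v = 1 - u := by linarith
    refine ⟨by positivity, ?_, by nlinarith, ?_⟩
    · rcases hu.eq_or_lt with rfl | hu'
      · linarith
      · nlinarith
    · rcases hu.eq_or_lt with rfl | hu'
      · linarith
      · nlinarith
  let Z : ℝ × ℝ → ℝ := fun p => ((γ p.1)⁻¹ * γ p.2).z
  have hZc : ContinuousOn Z U := by
    have g1 : ContinuousOn (fun p : ℝ × ℝ => γ p.1) U :=
      hγ.continuousOn.comp continuousOn_fst fun p hp => ⟨hp.1, hp.2.1.le.trans hp.2.2.1⟩
    have g2 : ContinuousOn (fun p : ℝ × ℝ => γ p.2) U :=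
      hγ.continuousOn.comp continuousOn_snd fun p hp => ⟨hp.1.trans hp.2.1.le, hp.2.2.1⟩
    have x1 := continuous_x.comp_continuousOn g1
    have y1 := continuous_y.comp_continuousOn g1
    have z1 := continuous_z.comp_continuousOn g1
    have x2 := continuous_x.comp_continuousOn g2
    have y2 := continuous_y.comp_continuousOn g2
    have z2 := continuous_z.comp_continuousOn g2
    exact ((z1.neg.add z2).add (continuousOn_const.mul (x2.mul y1.neg))).sub
      (continuousOn_const.mul (x1.neg.mul y2))
  have hZ0 : ∀ p ∈ U, Z p ≠ 0 := by
    rintro ⟨s, t⟩ ⟨h1, h2, h3, h4⟩ h0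
    simp only at h1 h2 h3 h4
    have hs : s ∈ Icc (0 : ℝ) 1 := ⟨h1, h2.le.trans h3⟩
    have ht : t ∈ Icc (0 : ℝ) 1 := ⟨h1.trans h2.le, h3⟩
    have := h s hs t ht (by rw [abs_sub_comm, abs_of_pos (by linarith)]; exact h4)
    have h0' : ((γ s)⁻¹ * γ t).z = 0 := h0
    rw [h0', abs_zero, sqDist, sq_eq_zero_iff, dist_eq_zero] at this
    exact h2.ne (hγ.injOn hs ht this)
  have hsign : (∀ p ∈ U, 0 < Z p) ∨ ∀ p ∈ U, Z p < 0 := by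
    by_contra! hcon
    obtain ⟨⟨p, hp, hp0⟩, ⟨q, hq, hq0⟩⟩ := hcon
    obtain ⟨w, hw, hw0⟩ := hUc.isPreconnected.intermediate_value hp hq hZc ⟨hp0, hq0⟩
    exact hZ0 w hw hw0
  have main : ∀ σ : ℝ, |σ| = 1 → (∀ p ∈ U, |Z p| = σ * Z p) → ∀ s t, 0 ≤ s → s ≤ t → t ≤ 1 →
      t - s < δ → sqDist γ s t = σ * ((γ s)⁻¹ * γ t).z := by
    intro σ _ hσ s t hs hst ht hd
    rcases hst.eq_or_lt with rfl | hlt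
    · simp [sqDist]
    · rw [h s ⟨hs, hst.trans ht⟩ t ⟨hs.trans hst, ht⟩
        (by rw [abs_sub_comm, abs_of_pos (by linarith)]; exact hd)]
      exact hσ (s, t) ⟨hs, hlt, ht, hd⟩
  rcases hsign with hpos | hneg
  · exact ⟨δ, hδ, 1, abs_one, main 1 abs_one fun p hp => by rw [abs_of_pos (hpos p hp), one_mul]⟩
  · refine ⟨δ, hδ, -1, by simp, main (-1) (by simp) fun p hp => ?_⟩
    rw [abs_of_neg (hneg p hp), neg_one_mul]

/-- The defect of additivity of the squared distance along a vertical curve. -/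
theorem IsVerticalCurve.exists_abs_defect_le (hγ : IsVerticalCurve F γ)
    (hF : ∀ A, HasHorizontalDiffAt F A (D A))
    (hD : ∀ A, ∀ ε > 0, ∃ δ > 0, ∀ B, dist A B < δ → NormLE (fun h => D B h - D A h) ε) :
    ∃ C > 0, ∃ δ > 0, ∀ s u t, 0 ≤ s → s ≤ u → u ≤ t → t ≤ 1 → t - s < δ →
      |sqDist γ s t - sqDist γ s u - sqDist γ u t| ≤
        C * (|D (γ u) ((γ u)⁻¹ * γ s) 0| * |D (γ u) ((γ u)⁻¹ * γ t) 1| +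
          |D (γ u) ((γ u)⁻¹ * γ s) 1| * |D (γ u) ((γ u)⁻¹ * γ t) 0|) := by
  obtain ⟨C, hC, hb⟩ := hγ.exists_bound hF hD
  obtain ⟨δ, hδ, σ, hσ, h⟩ := hγ.exists_sign hF hD
  refine ⟨2 * C, by positivity, δ, hδ, fun s u t hs hsu hut ht hd => ?_⟩
  have hu : u ∈ Icc (0 : ℝ) 1 := ⟨hs.trans hsu, hut.trans ht⟩
  rw [h s t hs (hsu.trans hut) ht hd, h s u hs hsu hu.2 (by linarith),
    h u t hu.1 hut ht (by linarith)]
  set g := (γ u)⁻¹ * γ s with hg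
  set k := (γ u)⁻¹ * γ t with hk
  -- The group law, based at the middle point `γ u`: only its bilinear term survives.
  have e : σ * ((γ s)⁻¹ * γ t).z - σ * ((γ s)⁻¹ * γ u).z - σ * k.z =
      σ * (2 * (g.x * k.y - k.x * g.y)) := by
    simp only [hg, hk, mul_x, mul_y, mul_z, inv_x, inv_y, inv_z]
    ring
  have h0 := hγ.hdet_ne_zero hF hu
  have hcr : g.x * k.y - k.x * g.y =
      (hdet (D (γ u)))⁻¹ * (D (γ u) g 0 * D (γ u) k 1 - D (γ u) g 1 * D (γ u) k 0) := by
    rw [← (hF (γ u)).isHorizontalHom.hdet_mul_cross, inv_mul_cancel_left₀ h0]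
  rw [e, abs_mul, hσ, one_mul, abs_mul, abs_two, hcr, abs_mul, abs_inv, mul_assoc]
  gcongr
  · exact (hb u hu).1
  · refine (abs_sub _ _).trans ?_
    rw [abs_mul, abs_mul]

end VerticalCurve

end Heis

/-! ### Sewing with Dini and power moduli -/

theorem abs_chainSum_sqDist_sub_le {X : Type*} [PseudoMetricSpace X] {γ : ℝ → X} {err : ℝ → ℝ}
    {s t e : ℝ} (herr : MonotoneOn err (Ici 0))
    (h8 : ∀ x y z, s ≤ x → x ≤ y → y ≤ z → z ≤ t →
      |sqDist γ x z - sqDist γ x y - sqDist γ y z| ≤ max (sqDist γ x y) (sqDist γ y z) / 8)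
    (hE : ∀ x y z, s ≤ x → x ≤ y → y ≤ z → z ≤ t →
      |sqDist γ x z - sqDist γ x y - sqDist γ y z| ≤ err (max (sqDist γ x y) (sqDist γ y z)))
    (hS : ∀ n : ℕ, ∑ k ∈ Finset.range n, err (6 * sqDist γ s t / (k + 1)) ≤ e)
    (he : e ≤ sqDist γ s t) (n : ℕ) (p : ℕ → ℝ) (hp : IsPartition p n s t) :
    |chainSum (sqDist γ) p n - sqDist γ s t| ≤ e := by
  rcases n with _ | n
  · have h0 := hS 0
    obtain rfl : s = t := hp.left.symm.trans hp.right
    simpa [chainSum, sqDist] using h0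
  · exact (abs_chainSum_sub_le (sqDist_nonneg γ) herr h8 hE (fun n => (hS n).trans he) n hp).trans
      (hS n)

theorem monotoneOn_mul_comp {μ : ℝ → ℝ} (hμ : MonotoneOn μ (Ici 0)) (hμ0 : ∀ x, 0 ≤ x → 0 ≤ μ x)
    {η c : ℝ} (hη : 0 ≤ η) (hc : 0 ≤ c) :
    MonotoneOn (fun x => η * x * μ (c * x)) (Ici 0) := by
  intro x hx y hy hxy
  rw [mem_Ici] at hx hy
  have h1 : μ (c * x) ≤ μ (c * y) :=
    hμ (mem_Ici.2 (by positivity)) (mem_Ici.2 (by positivity)) (by gcongr)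
  have h2 := hμ0 (c * x) (by positivity)
  change η * x * μ (c * x) ≤ η * y * μ (c * y)
  gcongr

/-- Sewing with the error `η x μ(9 x)` for a Dini modulus `μ`. -/
theorem nearlyAdditive_of_dini {X : Type*} [PseudoMetricSpace X] {γ : ℝ → X} {μ : ℝ → ℝ}
    (hμ : MonotoneOn μ (Ici 0)) (hμ0 : ∀ x, 0 ≤ x → 0 ≤ μ x)
    (hsum : Summable fun k : ℕ => μ (1 / (k + 1)) / (k + 1)) {η κ s t : ℝ} (hη : 0 ≤ η)
    (hηκ : η * (6 * ∑' k : ℕ, μ (1 / (k + 1)) / (k + 1)) ≤ κ) (hκ1 : κ ≤ 1)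
    (hq : 54 * sqDist γ s t ≤ 1)
    (h8 : ∀ x y z, s ≤ x → x ≤ y → y ≤ z → z ≤ t →
      |sqDist γ x z - sqDist γ x y - sqDist γ y z| ≤ max (sqDist γ x y) (sqDist γ y z) / 8)
    (hE : ∀ x y z, s ≤ x → x ≤ y → y ≤ z → z ≤ t →
      |sqDist γ x z - sqDist γ x y - sqDist γ y z| ≤
        η * max (sqDist γ x y) (sqDist γ y z) * μ (9 * max (sqDist γ x y) (sqDist γ y z))) :
    NearlyAdditive (sqDist γ) κ s t := by
  have hQ := sqDist_nonneg γ s t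
  set q := sqDist γ s t with hqdef
  refine abs_chainSum_sqDist_sub_le (err := fun x => η * x * μ (9 * x))
    (monotoneOn_mul_comp hμ hμ0 hη (by norm_num)) h8 hE (fun n => ?_)
    (mul_le_of_le_one_left hQ hκ1)
  calc ∑ k ∈ Finset.range n, η * (6 * q / (k + 1)) * μ (9 * (6 * q / (k + 1)))
      ≤ ∑ k ∈ Finset.range n, η * 6 * q * (μ (1 / (k + 1)) / (k + 1)) := by
        refine Finset.sum_le_sum fun k _ => ?_
        have hk : (0 : ℝ) < k + 1 := by positivity
        -- Here `54 = 9 * 6` in `hq` is used.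
        have h1 : μ (9 * (6 * q / (k + 1))) ≤ μ (1 / (k + 1)) := by
          refine hμ (mem_Ici.2 (by positivity)) (mem_Ici.2 (by positivity)) ?_
          rw [← mul_div_assoc]
          gcongr
          linarith
        calc η * (6 * q / (k + 1)) * μ (9 * (6 * q / (k + 1)))
            ≤ η * (6 * q / (k + 1)) * μ (1 / (k + 1)) := by gcongr
          _ = _ := by ring
    _ = η * 6 * q * ∑ k ∈ Finset.range n, μ (1 / (k + 1)) / (k + 1) := by
        rw [Finset.mul_sum]
    _ ≤ η * 6 * q * ∑' k : ℕ, μ (1 / (k + 1)) / (k + 1) := by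
        gcongr
        exact hsum.sum_le_tsum _ fun k _ => div_nonneg (hμ0 _ (by positivity)) (by positivity)
    _ = η * (6 * ∑' k : ℕ, μ (1 / (k + 1)) / (k + 1)) * q := by ring
    _ ≤ κ * q := by gcongr

theorem summable_rpow_modulus {β : ℝ} (hβ : 0 < β) :
    Summable fun k : ℕ => (1 / ((k : ℝ) + 1)) ^ β / (k + 1) := by
  have h := (summable_nat_add_iff 1).2 (Real.summable_one_div_nat_rpow.2 (by linarith : 1 < β + 1))
  refine h.congr fun k => ?_
  have hk : (0 : ℝ) < k + 1 := by positivity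
  push_cast
  rw [Real.rpow_add hk, Real.rpow_one, Real.div_rpow zero_le_one hk.le, Real.one_rpow, div_div]

/-- Sewing with the error `K x^{1 + β}`. -/
theorem abs_chainSum_sub_le_rpow {X : Type*} [PseudoMetricSpace X] {γ : ℝ → X} {β K K' s t : ℝ}
    (hβ : 0 < β) (hK : 0 ≤ K)
    (hK' : K * (6 * 6 ^ β * ∑' k : ℕ, (1 / ((k : ℝ) + 1)) ^ β / (k + 1)) ≤ K')
    (hq : K' * sqDist γ s t ^ β ≤ 1)
    (h8 : ∀ x y z, s ≤ x → x ≤ y → y ≤ z → z ≤ t →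
      |sqDist γ x z - sqDist γ x y - sqDist γ y z| ≤ max (sqDist γ x y) (sqDist γ y z) / 8)
    (hE : ∀ x y z, s ≤ x → x ≤ y → y ≤ z → z ≤ t →
      |sqDist γ x z - sqDist γ x y - sqDist γ y z| ≤
        K * max (sqDist γ x y) (sqDist γ y z) * max (sqDist γ x y) (sqDist γ y z) ^ β)
    (n : ℕ) (p : ℕ → ℝ) (hp : IsPartition p n s t) :
    |chainSum (sqDist γ) p n - sqDist γ s t| ≤ sqDist γ s t * (K' * sqDist γ s t ^ β) := by
  have hQ := sqDist_nonneg γ s t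
  have hmono : MonotoneOn (fun x : ℝ => x ^ β) (Ici 0) := fun x hx y _ hxy =>
    Real.rpow_le_rpow hx hxy hβ.le
  have hmono' := monotoneOn_mul_comp hmono (fun x hx => Real.rpow_nonneg hx β) hK zero_le_one
  simp only [one_mul] at hmono'
  refine abs_chainSum_sqDist_sub_le hmono' h8 hE (fun n => ?_)
    (mul_le_of_le_one_right hQ hq) n p hp
  set q := sqDist γ s t with hqdef
  calc ∑ k ∈ Finset.range n, K * (6 * q / (k + 1)) * (6 * q / (k + 1)) ^ β
      = K * (6 * 6 ^ β) * (q * q ^ β) *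
          ∑ k ∈ Finset.range n, (1 / ((k : ℝ) + 1)) ^ β / (k + 1) := by
        rw [Finset.mul_sum]
        refine Finset.sum_congr rfl fun k _ => ?_
        have hk : (0 : ℝ) < k + 1 := by positivity
        rw [show 6 * q / ((k : ℝ) + 1) = 6 * q * (1 / (k + 1)) by ring,
          Real.mul_rpow (by positivity) (by positivity), Real.mul_rpow (by norm_num) hQ]
        ring
    _ ≤ K * (6 * 6 ^ β) * (q * q ^ β) * ∑' k : ℕ, (1 / ((k : ℝ) + 1)) ^ β / (k + 1) := by
        gcongr
        exact (summable_rpow_modulus hβ).sum_le_tsum _ fun k _ => by positivity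
    _ = (q * q ^ β) * (K * (6 * 6 ^ β * ∑' k : ℕ, (1 / ((k : ℝ) + 1)) ^ β / (k + 1))) := by ring
    _ ≤ (q * q ^ β) * K' := by gcongr
    _ = _ := by ring

/-- Cauchy condensation: geometric summability of a modulus in an arbitrary base is the discrete
Dini condition. -/
theorem summable_modulus_div {m : ℝ≥0 → ℝ≥0} {r : ℝ≥0} (hm : Monotone m) (hr : 1 < r)
    (hs : Summable fun k : ℕ => m (r⁻¹ ^ k)) :
    Summable fun k : ℕ => (m (1 / ((k : ℝ) + 1)).toNNReal : ℝ) / (k + 1) := by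
  -- Since `r < 2 ^ K`, the values of `m` at `2⁻¹ ^ (K * k)` are dominated by those at `r⁻¹ ^ k`.
  obtain ⟨K, hK⟩ := pow_unbounded_of_one_lt r (one_lt_two (α := ℝ≥0))
  have hr0 : 0 < r := one_pos.trans hr
  have hK0 : K ≠ 0 := by
    rintro rfl
    rw [pow_zero] at hK
    exact absurd hK hr.not_gt
  have : NeZero K := ⟨hK0⟩
  let g : ℕ → ℝ := fun k => m (2⁻¹ ^ k)
  have hg : Antitone g := fun a b hab => by
    have : m (2⁻¹ ^ b) ≤ m (2⁻¹ ^ a) :=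
      hm (pow_le_pow_of_le_one (by positivity) (inv_le_one_of_one_le₀ one_le_two) hab)
    exact_mod_cast this
  have hg1 : Summable fun k : ℕ => g (K * k) := by
    refine Summable.of_nonneg_of_le (fun k => NNReal.coe_nonneg _) (fun k => ?_)
      (NNReal.summable_coe.2 hs)
    refine NNReal.coe_le_coe.2 (hm ?_)
    rw [pow_mul]
    refine pow_le_pow_left₀ (by positivity) ?_ k
    rw [inv_pow]
    exact inv_anti₀ hr0 hK.le
  have hg2 : Summable g := by
    -- An antitone sequence is summable as soon as it is summable on one residue class modulo `K`.
    rw [← summable_indicator_mod_iff hg (0 : ZMod K)]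
    have hinj : Function.Injective fun k : ℕ => K * k := fun a b h =>
      Nat.eq_of_mul_eq_mul_left (Nat.pos_of_ne_zero hK0) h
    rw [← hinj.summable_iff]
    · refine hg1.congr fun k => ?_
      simp [indicator]
    · intro n hn
      rw [indicator_of_notMem]
      intro hmem
      have h0 : ((n : ℕ) : ZMod K) = 0 := hmem
      rw [ZMod.natCast_eq_zero_iff] at h0
      obtain ⟨c, rfl⟩ := h0
      exact hn ⟨c, rfl⟩
  let f : ℕ → ℝ := fun n => (m (1 / (n : ℝ)).toNNReal : ℝ) / n
  have hf : Summable f := by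
    rw [← summable_condensed_iff_of_nonneg (fun n => by positivity)]
    · refine hg2.congr fun k => ?_
      have e : (1 / ((2 ^ k : ℕ) : ℝ)).toNNReal = 2⁻¹ ^ k := by
        rw [Real.toNNReal_of_nonneg (by positivity)]
        ext
        simp
      simp only [f, g, e]
      push_cast
      field_simp
    · intro a b ha hab
      have ha' : (0 : ℝ) < a := by exact_mod_cast ha
      have hab' : (a : ℝ) ≤ b := by exact_mod_cast hab
      simp only [f]
      have h1 : (m (1 / (b : ℝ)).toNNReal : ℝ) ≤ m (1 / (a : ℝ)).toNNReal :=
        NNReal.coe_le_coe.2 (hm (Real.toNNReal_le_toNNReal (by gcongr)))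
      gcongr
  have := (summable_nat_add_iff 1).2 hf
  refine this.congr fun k => ?_
  simp [f]

/-! ### Defect bounds and measure estimates along vertical curves -/

namespace Heis

section VerticalCurve

variable {F : Heis → EuclideanSpace ℝ (Fin 2)} {D : Heis → Heis → EuclideanSpace ℝ (Fin 2)}
  {γ : ℝ → Heis}

/-- Both products in the defect contain a factor of index `i`, bounded through `P`; the other factor
is bounded through `R`. Finally the product of the two distances is at most the larger squared
distance. -/
theorem IsVerticalCurve.exists_abs_defect_le_mul (hγ : IsVerticalCurve F γ)
    (hF : ∀ A, HasHorizontalDiffAt F A (D A))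
    (hD : ∀ A, ∀ ε > 0, ∃ δ > 0, ∀ B, dist A B < δ → NormLE (fun h => D B h - D A h) ε) :
    ∃ C > 0, ∃ δ > 0, ∀ s u t, 0 ≤ s → s ≤ u → u ≤ t → t ≤ 1 → t - s < δ →
      ∀ (i : Fin 2) (P R : ℝ), 0 ≤ P → 0 ≤ R →
      |D (γ u) ((γ u)⁻¹ * γ s) i| ≤ P * dist (γ u) (γ s) →
      |D (γ u) ((γ u)⁻¹ * γ t) i| ≤ P * dist (γ u) (γ t) →
      ‖D (γ u) ((γ u)⁻¹ * γ s)‖ ≤ R * dist (γ u) (γ s) →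
      ‖D (γ u) ((γ u)⁻¹ * γ t)‖ ≤ R * dist (γ u) (γ t) →
      |sqDist γ s t - sqDist γ s u - sqDist γ u t| ≤
        C * (P * R) * max (sqDist γ s u) (sqDist γ u t) := by
  obtain ⟨C, hC, δ, hδ, h⟩ := hγ.exists_abs_defect_le hF hD
  refine ⟨2 * C, by positivity, δ, hδ, ?_⟩
  intro s u t hs hsu hut ht hd i P R hP hR a1 a2 b1 b2
  refine (h s u t hs hsu hut ht hd).trans ?_
  have n := fun (v : EuclideanSpace ℝ (Fin 2)) i => PiLp.norm_apply_le v i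
  simp only [Real.norm_eq_abs] at n
  set d₁ := dist (γ u) (γ s) with hd₁
  set d₂ := dist (γ u) (γ t) with hd₂
  have hd₁0 : 0 ≤ d₁ := dist_nonneg
  have hd₂0 : 0 ≤ d₂ := dist_nonneg
  have hM : d₁ * d₂ ≤ max (sqDist γ s u) (sqDist γ u t) := by
    have h1 : d₁ ^ 2 ≤ max (sqDist γ s u) (sqDist γ u t) := by
      rw [hd₁, dist_comm]
      exact le_max_left _ _
    have h2 : d₂ ^ 2 ≤ max (sqDist γ s u) (sqDist γ u t) := le_max_right _ _
    nlinarith [sq_nonneg (d₁ - d₂)]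
  have key : ∀ j k : Fin 2, (j = i ∨ k = i) →
      |D (γ u) ((γ u)⁻¹ * γ s) j| * |D (γ u) ((γ u)⁻¹ * γ t) k| ≤ P * R * (d₁ * d₂) := by
    rintro j k (rfl | rfl)
    · have := mul_le_mul a1 ((n _ k).trans b2) (abs_nonneg _) (by positivity)
      linarith
    · have := mul_le_mul ((n _ j).trans b1) a2 (abs_nonneg _) (by positivity)
      linarith
  have k1 := key 0 1 (by fin_cases i <;> simp)
  have k2 := key 1 0 (by fin_cases i <;> simp)
  have k3 : P * R * (d₁ * d₂) ≤ P * R * max (sqDist γ s u) (sqDist γ u t) := by gcongr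
  calc _ ≤ C * (P * R * max (sqDist γ s u) (sqDist γ u t) +
        P * R * max (sqDist γ s u) (sqDist γ u t)) := by
        exact mul_le_mul_of_nonneg_left (add_le_add (k1.trans k3) (k2.trans k3)) hC.le
    _ = _ := by ring

theorem IsVerticalCurve.exists_abs_defect_le_div_eight (hγ : IsVerticalCurve F γ)
    (hF : ∀ A, HasHorizontalDiffAt F A (D A))
    (hD : ∀ A, ∀ ε > 0, ∃ δ > 0, ∀ B, dist A B < δ → NormLE (fun h => D B h - D A h) ε) :
    ∃ δ > 0, ∀ s u t, 0 ≤ s → s ≤ u → u ≤ t → t ≤ 1 → t - s < δ →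
      |sqDist γ s t - sqDist γ s u - sqDist γ u t| ≤
        max (sqDist γ s u) (sqDist γ u t) / 8 := by
  obtain ⟨C, hC, δ₁, hδ₁, h1⟩ := hγ.exists_abs_defect_le_mul hF hD
  set ε := min 1 (1 / (8 * C)) with hε
  have hε0 : 0 < ε := lt_min one_pos (by positivity)
  obtain ⟨δ₂, hδ₂, h2⟩ := hγ.exists_norm_apply_le hF hD hε0
  refine ⟨min δ₁ δ₂, lt_min hδ₁ hδ₂, fun s u t hs hsu hut ht hd => ?_⟩
  have hs' : s ∈ Icc (0 : ℝ) 1 := ⟨hs, (hsu.trans hut).trans ht⟩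
  have hu' : u ∈ Icc (0 : ℝ) 1 := ⟨hs.trans hsu, hut.trans ht⟩
  have ht' : t ∈ Icc (0 : ℝ) 1 := ⟨(hs.trans hsu).trans hut, ht⟩
  obtain ⟨hd1, hd2⟩ := lt_min_iff.1 hd
  have b1 := h2 u hu' s hs' (by rw [abs_of_nonneg (by linarith)]; linarith)
  have b2 := h2 u hu' t ht' (by rw [abs_sub_comm, abs_of_nonneg (by linarith)]; linarith)
  have n := fun (v : EuclideanSpace ℝ (Fin 2)) i => PiLp.norm_apply_le v i
  simp only [Real.norm_eq_abs] at n
  refine (h1 s u t hs hsu hut ht hd1 0 ε ε hε0.le hε0.le ((n _ 0).trans b1) ((n _ 0).trans b2)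
    b1 b2).trans ?_
  have hM : 0 ≤ max (sqDist γ s u) (sqDist γ u t) := le_max_of_le_left (sqDist_nonneg _ _ _)
  have : C * (ε * ε) ≤ 1 / 8 := by
    calc C * (ε * ε) ≤ C * (1 / (8 * C) * 1) := by
          gcongr
          · exact min_le_right _ _
          · exact min_le_left _ _
      _ = 1 / 8 := by field_simp
  nlinarith

/-- The modulus controls the component `i`; the arbitrarily small `η` comes from the other factor,
for which `C¹_H` suffices. -/
theorem IsVerticalCurve.exists_abs_defect_le_modulus (hγ : IsVerticalCurve F γ)
    (hF : ∀ A, HasHorizontalDiffAt F A (D A))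
    (hD : ∀ A, ∀ ε > 0, ∃ δ > 0, ∀ B, dist A B < δ → NormLE (fun h => D B h - D A h) ε)
    {i : Fin 2} {μ : ℝ → ℝ} (hμ : MonotoneOn μ (Ici 0)) (hμ0 : ∀ x, 0 ≤ x → 0 ≤ μ x)
    (he : ∀ s ∈ Icc (0 : ℝ) 1, ∀ t ∈ Icc (0 : ℝ) 1, |D (γ s) ((γ s)⁻¹ * γ t) i| ≤
      6 * μ (9 * dist (γ s) (γ t) ^ 2) * dist (γ s) (γ t)) {η : ℝ} (hη : 0 < η) :
    ∃ δ > 0, ∀ s u t, 0 ≤ s → s ≤ u → u ≤ t → t ≤ 1 → t - s < δ →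
      |sqDist γ s t - sqDist γ s u - sqDist γ u t| ≤
        η * max (sqDist γ s u) (sqDist γ u t) * μ (9 * max (sqDist γ s u) (sqDist γ u t)) := by
  obtain ⟨C, hC, δ₁, hδ₁, h1⟩ := hγ.exists_abs_defect_le_mul hF hD
  set ε := η / (6 * C) with hε
  have hε0 : 0 < ε := by positivity
  obtain ⟨δ₂, hδ₂, h2⟩ := hγ.exists_norm_apply_le hF hD hε0
  refine ⟨min δ₁ δ₂, lt_min hδ₁ hδ₂, fun s u t hs hsu hut ht hd => ?_⟩
  have hs' : s ∈ Icc (0 : ℝ) 1 := ⟨hs, (hsu.trans hut).trans ht⟩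
  have hu' : u ∈ Icc (0 : ℝ) 1 := ⟨hs.trans hsu, hut.trans ht⟩
  have ht' : t ∈ Icc (0 : ℝ) 1 := ⟨(hs.trans hsu).trans hut, ht⟩
  obtain ⟨hd1, hd2⟩ := lt_min_iff.1 hd
  have b1 := h2 u hu' s hs' (by rw [abs_of_nonneg (by linarith)]; linarith)
  have b2 := h2 u hu' t ht' (by rw [abs_sub_comm, abs_of_nonneg (by linarith)]; linarith)
  set M := max (sqDist γ s u) (sqDist γ u t) with hM
  have hM0 : 0 ≤ M := le_max_of_le_left (sqDist_nonneg _ _ _)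
  have mono : ∀ d : ℝ, d ^ 2 ≤ M → μ (9 * d ^ 2) ≤ μ (9 * M) := fun d hd =>
    hμ (mem_Ici.2 (by positivity)) (mem_Ici.2 (by positivity)) (by gcongr)
  have m1 := mono (dist (γ u) (γ s)) (by rw [dist_comm]; exact le_max_left _ _)
  have m2 := mono (dist (γ u) (γ t)) (le_max_right _ _)
  have hμM := hμ0 (9 * M) (by positivity)
  refine (h1 s u t hs hsu hut ht hd1 i (6 * μ (9 * M)) ε (by positivity) hε0.le
    ((he u hu' s hs').trans (by gcongr)) ((he u hu' t ht').trans (by gcongr)) b1 b2).trans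
    (le_of_eq ?_)
  rw [hε, ← hM]
  field_simp

theorem IsVerticalCurve.exists_nearlyAdditive (hγ : IsVerticalCurve F γ)
    (hF : ∀ A, HasHorizontalDiffAt F A (D A))
    (hD : ∀ A, ∀ ε > 0, ∃ δ > 0, ∀ B, dist A B < δ → NormLE (fun h => D B h - D A h) ε)
    {i : Fin 2} {μ : ℝ → ℝ} (hμ : MonotoneOn μ (Ici 0)) (hμ0 : ∀ x, 0 ≤ x → 0 ≤ μ x)
    (hsum : Summable fun k : ℕ => μ (1 / (k + 1)) / (k + 1))
    (he : ∀ s ∈ Icc (0 : ℝ) 1, ∀ t ∈ Icc (0 : ℝ) 1, |D (γ s) ((γ s)⁻¹ * γ t) i| ≤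
      6 * μ (9 * dist (γ s) (γ t) ^ 2) * dist (γ s) (γ t)) {κ : ℝ} (hκ : 0 < κ) :
    ∃ δ > 0, ∀ s t, 0 ≤ s → s ≤ t → t ≤ 1 → t - s < δ → NearlyAdditive (sqDist γ) κ s t := by
  set S := ∑' k : ℕ, μ (1 / (k + 1)) / (k + 1) with hS
  have hS0 : 0 ≤ S := tsum_nonneg fun k => div_nonneg (hμ0 _ (by positivity)) (by positivity)
  -- The cut-off at 1 is required by sewing, whose total error may not exceed `Q s t`; `S + 1`
  -- avoids a division by zero.
  set κ' := min κ 1 with hκ'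
  have hκ'0 : 0 < κ' := lt_min hκ one_pos
  set η := κ' / (6 * (S + 1)) with hη
  have hη0 : 0 < η := by positivity
  obtain ⟨δ₁, hδ₁, h1⟩ := hγ.exists_abs_defect_le_div_eight hF hD
  obtain ⟨δ₂, hδ₂, h2⟩ := hγ.exists_abs_defect_le_modulus hF hD hμ hμ0 he hη0
  obtain ⟨δ₃, hδ₃, h3⟩ := hγ.exists_dist_lt (η := 1 / 54) (by norm_num)
  refine ⟨min δ₁ (min δ₂ δ₃), by positivity, fun s t hs hst ht hd => ?_⟩
  obtain ⟨d1, hd'⟩ := lt_min_iff.1 hd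
  obtain ⟨d2, d3⟩ := lt_min_iff.1 hd'
  have hna : NearlyAdditive (sqDist γ) κ' s t := by
    refine nearlyAdditive_of_dini hμ hμ0 hsum hη0.le ?_ (min_le_right _ _) ?_ ?_ ?_
    · rw [← hS, hη]
      calc κ' / (6 * (S + 1)) * (6 * S) = κ' * (S / (S + 1)) := by field_simp
        _ ≤ κ' * 1 := by
          gcongr
          exact (div_le_one (by positivity)).2 (by linarith)
        _ = κ' := mul_one _
    · have := h3 s ⟨hs, hst.trans ht⟩ t ⟨hs.trans hst, ht⟩
        (by rw [abs_sub_comm, abs_of_nonneg (by linarith)]; exact d3)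
      have h0 : 0 ≤ dist (γ s) (γ t) := dist_nonneg
      rw [sqDist]
      nlinarith
    · intro x y z hx hxy hyz hz
      exact h1 x y z (hs.trans hx) hxy hyz (hz.trans ht) (by linarith)
    · intro x y z hx hxy hyz hz
      exact h2 x y z (hs.trans hx) hxy hyz (hz.trans ht) (by linarith)
  intro n p hp
  refine (hna n p hp).trans ?_
  have := sqDist_nonneg γ s t
  gcongr
  exact min_le_left _ _

theorem IsVerticalCurve.arcEstimate_of_chainSum (hγ : IsVerticalCurve F γ)
    (h : ∀ κ > 0, ∃ δ > 0, ∀ s t, 0 ≤ s → s ≤ t → t ≤ 1 → t - s < δ →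
      NearlyAdditive (sqDist γ) κ s t) {s t e : ℝ} (hs : 0 ≤ s) (hst : s ≤ t) (ht : t ≤ 1)
    (he : ∀ n p, IsPartition p n s t → |chainSum (sqDist γ) p n - sqDist γ s t| ≤ e) :
    ArcEstimate γ s t e := by
  have hsub : Icc s t ⊆ Icc 0 1 := Icc_subset_Icc hs ht
  refine abs_hausdorffMeasure_arc_sub_le hst (hγ.continuousOn.mono hsub) (hγ.injOn.mono hsub)
    (fun κ hκ => ?_) he
  obtain ⟨δ, hδ, h'⟩ := h κ hκ
  exact ⟨δ, hδ, fun a b ha hab hb => h' a b (hs.trans ha) hab (hb.trans ht)⟩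

theorem IsVerticalCurve.isStronglyAhlforsRegular (hγ : IsVerticalCurve F γ)
    (h : ∀ κ > 0, ∃ δ > 0, ∀ s t, 0 ≤ s → s ≤ t → t ≤ 1 → t - s < δ →
      NearlyAdditive (sqDist γ) κ s t) : IsStronglyAhlforsRegular γ := by
  intro ε hε
  obtain ⟨δ₁, hδ₁, h1⟩ := h ε hε
  obtain ⟨δ, hδ, h2⟩ := hγ.exists_param_lt hδ₁
  refine ⟨δ, hδ, fun s t hs hst ht hd => hγ.arcEstimate_of_chainSum h hs hst ht ?_⟩
  have := h2 s ⟨hs, hst.trans ht⟩ t ⟨hs.trans hst, ht⟩ hd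
  rw [abs_sub_comm, abs_of_nonneg (by linarith)] at this
  exact h1 s t hs hst ht this

theorem sqDist_rpow_half (γ : ℝ → Heis) (s t α : ℝ) :
    sqDist γ s t ^ (α / 2) = dist (γ s) (γ t) ^ α := by
  rw [sqDist, ← Real.rpow_natCast, ← Real.rpow_mul dist_nonneg]
  congr 1
  push_cast
  ring

theorem exists_rpow_le_one {β : ℝ} (hβ : 0 < β) (K : ℝ) :
    ∃ ρ > 0, ∀ x : ℝ, 0 ≤ x → x < ρ → K * x ^ β ≤ 1 := by
  have hc : ContinuousAt (fun x : ℝ => K * x ^ β) 0 :=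
    (continuousAt_const.mul (Real.continuousAt_rpow_const _ _ (Or.inr hβ.le)))
  have hlt : K * (0 : ℝ) ^ β < 1 := by
    rw [Real.zero_rpow hβ.ne', mul_zero]
    exact one_pos
  obtain ⟨ρ, hρ, h⟩ := Metric.eventually_nhds_iff.1 (hc.eventually_lt_const hlt)
  refine ⟨ρ, hρ, fun x hx hxρ => (h ?_).le⟩
  rwa [Real.dist_eq, sub_zero, abs_of_nonneg hx]

/-- If the defect of additivity is `O(M^{1 + β})` on small arcs, the measure of small arcs is
`d_∞² + O(d_∞^{2 + 2β})`. -/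
theorem IsVerticalCurve.exists_arcEstimate_rpow (hγ : IsVerticalCurve F γ)
    (hF : ∀ A, HasHorizontalDiffAt F A (D A))
    (hD : ∀ A, ∀ ε > 0, ∃ δ > 0, ∀ B, dist A B < δ → NormLE (fun h => D B h - D A h) ε)
    (h : ∀ κ > 0, ∃ δ > 0, ∀ s t, 0 ≤ s → s ≤ t → t ≤ 1 → t - s < δ →
      NearlyAdditive (sqDist γ) κ s t)
    {β K K' δ₀ : ℝ} (hβ : 0 < β) (hK : 0 ≤ K)
    (hK' : K * (6 * 6 ^ β * ∑' k : ℕ, (1 / ((k : ℝ) + 1)) ^ β / (k + 1)) ≤ K') (hδ₀ : 0 < δ₀)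
    (hE : ∀ s u t, 0 ≤ s → s ≤ u → u ≤ t → t ≤ 1 → t - s < δ₀ →
      |sqDist γ s t - sqDist γ s u - sqDist γ u t| ≤
        K * max (sqDist γ s u) (sqDist γ u t) * max (sqDist γ s u) (sqDist γ u t) ^ β) :
    ∃ δ > 0, ∀ s t, 0 ≤ s → s ≤ t → t ≤ 1 → dist (γ s) (γ t) < δ →
      ArcEstimate γ s t (sqDist γ s t * (K' * sqDist γ s t ^ β)) := by
  obtain ⟨δ₁, hδ₁, h1⟩ := hγ.exists_abs_defect_le_div_eight hF hD
  obtain ⟨δ₂, hδ₂, h2⟩ := hγ.exists_param_lt (lt_min hδ₀ hδ₁)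
  obtain ⟨ρ, hρ, h3⟩ := exists_rpow_le_one hβ K'
  -- A distance below 1 is at least its square, so `sqDist γ s t < ρ`.
  refine ⟨min δ₂ (min 1 ρ), by positivity, fun s t hs hst ht hd => ?_⟩
  obtain ⟨d2, hd'⟩ := lt_min_iff.1 hd
  obtain ⟨d3, d4⟩ := lt_min_iff.1 hd'
  have hp := h2 s ⟨hs, hst.trans ht⟩ t ⟨hs.trans hst, ht⟩ d2
  rw [abs_sub_comm, abs_of_nonneg (by linarith)] at hp
  obtain ⟨p0, p1⟩ := lt_min_iff.1 hp
  have hq : K' * sqDist γ s t ^ β ≤ 1 := by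
    refine h3 _ (sqDist_nonneg _ _ _) ?_
    have h0 : 0 ≤ dist (γ s) (γ t) := dist_nonneg
    rw [sqDist]
    nlinarith
  refine hγ.arcEstimate_of_chainSum h hs hst ht (abs_chainSum_sub_le_rpow hβ hK hK' hq ?_ ?_)
  · intro x y z hx hxy hyz hz
    exact h1 x y z (hs.trans hx) hxy hyz (hz.trans ht) (by linarith)
  · intro x y z hx hxy hyz hz
    exact hE x y z (hs.trans hx) hxy hyz (hz.trans ht) (by linarith)

/-- The arc is a finite union of short arcs of finite measure. This is what makes a crude bound
available for long sub-arcs. -/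
theorem IsVerticalCurve.hausdorffMeasure_image_ne_top (hγ : IsVerticalCurve F γ) {δ : ℝ}
    (hδ : 0 < δ) (h : ∀ s t, 0 ≤ s → s ≤ t → t ≤ 1 → dist (γ s) (γ t) < δ →
      (μH[2] (γ '' Icc s t) : ℝ≥0∞) ≠ ∞) : (μH[2] (γ '' Icc 0 1) : ℝ≥0∞) ≠ ∞ := by
  obtain ⟨δ₁, hδ₁, h1⟩ := hγ.exists_dist_lt hδ
  obtain ⟨n, hn, hn0⟩ := ((eventually_uniformPartition_succ_sub_lt 0 1 hδ₁).and
    (eventually_gt_atTop 0)).exists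
  have hp := isPartition_uniformPartition (zero_le_one (α := ℝ)) hn0.ne'
  set p := uniformPartition 0 1 n with hpdef
  have key : ∀ k ≤ n, (μH[2] (γ '' Icc 0 (p k)) : ℝ≥0∞) ≠ ∞ := by
    intro k
    induction k with
    | zero =>
      intro _
      rw [hp.left]
      exact h 0 0 le_rfl le_rfl zero_le_one (by rwa [dist_self])
    | succ k ih =>
      intro hk
      have hl := hp.mem_Icc (k := k) (by omega)
      have hr := hp.mem_Icc hk
      have hle := hp.mono (Nat.le_succ k)
      rw [hausdorffMeasure_arc_add hγ.continuousOn hγ.injOn le_rfl hl.1 hle hr.2]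
      refine ENNReal.add_ne_top.2 ⟨ih (by omega), h _ _ hl.1 hle hr.2 (h1 _ hl _ hr ?_)⟩
      have := hn k
      rw [abs_sub_comm, abs_of_nonneg (sub_nonneg.2 hle)]
      exact this
  have := key n le_rfl
  rwa [hp.right] at this

/-- An estimate on small sub-arcs extends to all sub-arcs with a larger constant. -/
theorem IsVerticalCurve.exists_arcEstimate_of_small (hγ : IsVerticalCurve F γ) {α K δ : ℝ}
    (hα : 0 < α) (hK : 0 ≤ K) (hδ : 0 < δ)
    (h : ∀ s t, 0 ≤ s → s ≤ t → t ≤ 1 → dist (γ s) (γ t) < δ →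
      ArcEstimate γ s t (dist (γ s) (γ t) ^ 2 * (K * dist (γ s) (γ t) ^ α))) :
    ∃ C : ℝ, ∀ s t, 0 ≤ s → s ≤ t → t ≤ 1 →
      ArcEstimate γ s t (dist (γ s) (γ t) ^ 2 * (C * dist (γ s) (γ t) ^ α)) := by
  have hfin := hγ.hausdorffMeasure_image_ne_top hδ fun s t hs hst ht hd => (h s t hs hst ht hd).1
  set H := (μH[2] (γ '' Icc 0 1) : ℝ≥0∞).toReal with hH
  have hH0 : 0 ≤ H := ENNReal.toReal_nonneg
  set Δ := Metric.diam (γ '' Icc 0 1) with hΔ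
  have hpos : 0 < δ ^ 2 * δ ^ α := by positivity
  -- On arcs with chord at least `δ` the difference is at most `H + Δ ^ 2`; the second summand of
  -- the constant converts this into the required power.
  refine ⟨K + (H + Δ ^ 2) / (δ ^ 2 * δ ^ α), fun s t hs hst ht => ?_⟩
  have hd0 : 0 ≤ dist (γ s) (γ t) := dist_nonneg
  rcases lt_or_ge (dist (γ s) (γ t)) δ with hd | hd
  · obtain ⟨h1, h2⟩ := h s t hs hst ht hd
    refine ⟨h1, h2.trans ?_⟩
    gcongr
    exact le_add_of_nonneg_right (by positivity)
  · have hsub : γ '' Icc s t ⊆ γ '' Icc 0 1 := image_mono (Icc_subset_Icc hs ht)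
    have hle := measure_mono (μ := μH[2]) hsub
    have hm : (μH[2] (γ '' Icc s t) : ℝ≥0∞).toReal ≤ H := ENNReal.toReal_mono hfin hle
    refine ⟨(hle.trans_lt hfin.lt_top).ne, ?_⟩
    have hdΔ : dist (γ s) (γ t) ≤ Δ :=
      Metric.dist_le_diam_of_mem hγ.isCompact_image.isBounded
        (mem_image_of_mem _ ⟨hs, hst.trans ht⟩) (mem_image_of_mem _ ⟨hs.trans hst, ht⟩)
    have hsq : dist (γ s) (γ t) ^ 2 ≤ Δ ^ 2 := by gcongr
    have hm0 : 0 ≤ (μH[2] (γ '' Icc s t) : ℝ≥0∞).toReal := ENNReal.toReal_nonneg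
    have h1 : |(μH[2] (γ '' Icc s t) : ℝ≥0∞).toReal - dist (γ s) (γ t) ^ 2| ≤ H + Δ ^ 2 := by
      rw [abs_le]
      constructor <;> nlinarith [sq_nonneg (dist (γ s) (γ t))]
    have h2 : δ ^ 2 * δ ^ α ≤ dist (γ s) (γ t) ^ 2 * dist (γ s) (γ t) ^ α := by gcongr
    refine h1.trans ?_
    calc H + Δ ^ 2 = (H + Δ ^ 2) / (δ ^ 2 * δ ^ α) * (δ ^ 2 * δ ^ α) := by
          field_simp
      _ ≤ (K + (H + Δ ^ 2) / (δ ^ 2 * δ ^ α)) *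
          (dist (γ s) (γ t) ^ 2 * dist (γ s) (γ t) ^ α) := by
          gcongr
          exact le_add_of_nonneg_left hK
      _ = _ := by ring

end VerticalCurve

/-! ### Moduli for the components from the regularity hypotheses -/

section Components

variable {F : Heis → EuclideanSpace ℝ (Fin 2)} {D : Heis → Heis → EuclideanSpace ℝ (Fin 2)}

theorem HasHorizontalDiffAt.coord {A : Heis} {L : Heis → EuclideanSpace ℝ (Fin 2)}
    (hF : HasHorizontalDiffAt F A L) (i : Fin 2) :
    HasHorizontalDiffAt (fun P => F P i) A (fun h => L h i) :=
  hF.comp_clm (EuclideanSpace.proj (𝕜 := ℝ) i)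

theorem abs_coord_le_of_modulus (hF : ∀ A, HasHorizontalDiffAt F A (D A)) {i : Fin 2}
    {m : ℝ≥0 → ℝ≥0} (hm : Monotone m)
    (h : ∀ A B : Heis, max |derivX (fun P => F P i) A - derivX (fun P => F P i) B|
      |derivY (fun P => F P i) A - derivY (fun P => F P i) B| ≤ m (nndist A B ^ 2))
    {A B : Heis} (hAB : F A = F B) :
    |D A (A⁻¹ * B) i| ≤ 6 * (m (9 * dist A B ^ 2).toNNReal : ℝ) * dist A B := by
  have hf := fun A => (hF A).coord i
  -- The factor 2 passes from the two derivatives to the homomorphism norm; the mean value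
  -- inequality evaluates this modulus at three times the distance, whence `6 = 3 * 2` and `9 = 3 ^
  -- 2`.
  have hmono : MonotoneOn (fun r : ℝ => 2 * (m (r ^ 2).toNNReal : ℝ)) (Ici 0) := by
    intro x hx y _ hxy
    have hx' : 0 ≤ x := hx
    have : (m (x ^ 2).toNNReal : ℝ) ≤ m (y ^ 2).toNNReal :=
      NNReal.coe_le_coe.2 (hm (Real.toNNReal_le_toNNReal (by gcongr)))
    change 2 * (m (x ^ 2).toNNReal : ℝ) ≤ 2 * (m (y ^ 2).toNNReal : ℝ)
    gcongr
  have key := norm_apply_le_of_modulus hf hmono (fun r _ => by positivity) (fun A B => by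
    have h' := h B A
    have e : nndist B A ^ 2 = (dist A B ^ 2).toNNReal := by
      rw [dist_comm, ← coe_nndist, ← NNReal.coe_pow, Real.toNNReal_coe]
    rw [(hf A).derivX_eq, (hf B).derivX_eq, (hf A).derivY_eq, (hf B).derivY_eq, e] at h'
    exact (hf B).isHorizontalHom.normLE_sub (hf A).isHorizontalHom
      ((le_max_left _ _).trans h') ((le_max_right _ _).trans h')) (A := A) (B := B)
    (by rw [hAB])
  rw [mul_pow] at key
  norm_num at key
  linarith

theorem norm_apply_le_of_isC1AlphaH {E : Type*} [NormedAddCommGroup E] [NormedSpace ℝ E]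
    {f : Heis → E} {D : Heis → Heis → E} (hf : ∀ A, HasHorizontalDiffAt f A (D A)) {α : ℝ}
    (hα : 0 < α) (h : IsC1AlphaH α f) :
    ∃ M : ℝ, 0 ≤ M ∧ ∀ A B : Heis, f A = f B →
      ‖D A (A⁻¹ * B)‖ ≤ 6 * (M * (9 * dist A B ^ 2) ^ (α / 2)) * dist A B := by
  obtain ⟨D', hD', M, hM⟩ := h
  obtain rfl : D' = D := funext fun A => (hD' A).unique (hf A)
  refine ⟨|M|, abs_nonneg M, fun A B hAB => ?_⟩
  have hmono : MonotoneOn (fun r : ℝ => |M| * r ^ α) (Ici 0) := fun x hx y _ hxy =>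
    mul_le_mul_of_nonneg_left (Real.rpow_le_rpow hx hxy hα.le) (abs_nonneg M)
  have key := norm_apply_le_of_modulus hf hmono (fun r hr => by positivity)
    (fun A B P => (hM A B P).trans (mul_le_mul_of_nonneg_right
      (mul_le_mul_of_nonneg_right (le_abs_self M) (by positivity)) (rho_nonneg P))) hAB
  have hd : 0 ≤ dist A B := dist_nonneg
  have e : (9 * dist A B ^ 2) ^ (α / 2) = (3 * dist A B) ^ α := by
    rw [show 9 * dist A B ^ 2 = (3 * dist A B) ^ 2 by ring, ← Real.rpow_natCast,
      ← Real.rpow_mul (by positivity)]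
    congr 1
    push_cast
    ring
  -- The mean value inequality gives the constant 3; it is relaxed to 6 to share the form of the
  -- estimate from `m`.
  rw [e]
  refine key.trans ?_
  gcongr
  norm_num

end Components

end Heis

theorem mainTheorem6 (F : Heis → EuclideanSpace ℝ (Fin 2)) (hF : Heis.IsC1H F)
    (γ : ℝ → Heis) (hγ : Heis.IsVerticalCurve F γ) :
    -- horizontal derivatives of one component with a summable modulus of continuity
    (∀ (i : Fin 2) (m : ℝ≥0 → ℝ≥0) (r : ℝ≥0), Monotone m → 1 < r →
      Summable (fun k : ℕ => m (r⁻¹ ^ k)) →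
      (∀ A B : Heis,
        max |Heis.derivX (fun P => F P i) A - Heis.derivX (fun P => F P i) B|
            |Heis.derivY (fun P => F P i) A - Heis.derivY (fun P => F P i) B|
          ≤ m (nndist A B ^ 2)) →
      Heis.IsStronglyAhlforsRegular γ) ∧
    -- one component of class `C^{1,α}_H`
    (∀ (i : Fin 2) (α : ℝ), 0 < α → Heis.IsC1AlphaH α (fun P => F P i) →
      ∀ ε > 0, ∃ δ > 0, ∀ s t, 0 ≤ s → s ≤ t → t ≤ 1 → dist (γ s) (γ t) < δ →
        Heis.ArcEstimate γ s t (dist (γ s) (γ t) ^ 2 * (ε * dist (γ s) (γ t) ^ α))) ∧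
    -- both components of class `C^{1,α}_H`
    (∀ α : ℝ, 0 < α → Heis.IsC1AlphaH α F →
      ∃ C : ℝ, ∀ s t, 0 ≤ s → s ≤ t → t ≤ 1 →
        Heis.ArcEstimate γ s t (dist (γ s) (γ t) ^ 2 * (C * dist (γ s) (γ t) ^ (2 * α)))) := by
  obtain ⟨D, hFD, hD⟩ := hF
  have hlevel : ∀ s ∈ Icc (0 : ℝ) 1, ∀ t ∈ Icc (0 : ℝ) 1, F (γ s) = F (γ t) :=
    fun s hs t ht => by rw [hγ.mem_level s hs, hγ.mem_level t ht]
  have hpow : ∀ {α M : ℝ}, 0 < α → 0 ≤ M →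
      MonotoneOn (fun x : ℝ => M * x ^ (α / 2)) (Ici 0) ∧
      (∀ x : ℝ, 0 ≤ x → 0 ≤ M * x ^ (α / 2)) ∧
      Summable fun k : ℕ => M * (1 / ((k : ℝ) + 1)) ^ (α / 2) / (k + 1) := by
    intro α M hα hM
    refine ⟨fun x hx y _ hxy => mul_le_mul_of_nonneg_left
      (Real.rpow_le_rpow hx hxy (by positivity)) hM, fun x hx => by positivity, ?_⟩
    simp only [mul_div_assoc]
    exact (summable_rpow_modulus (by positivity)).mul_left M
  refine ⟨fun i m r hm hr hsum h => ?_, fun i α hα h ε hε => ?_, fun α hα h => ?_⟩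
  · refine hγ.isStronglyAhlforsRegular fun κ hκ => hγ.exists_nearlyAdditive hFD hD (i := i)
      (μ := fun x => (m x.toNNReal : ℝ))
      (fun x _ y _ hxy => NNReal.coe_le_coe.2 (hm (Real.toNNReal_le_toNNReal hxy)))
      (fun x _ => NNReal.coe_nonneg _) (summable_modulus_div hm hr hsum)
      (fun s hs t ht => Heis.abs_coord_le_of_modulus hFD hm h (hlevel s hs t ht)) hκ
  · obtain ⟨M, hM, he⟩ := Heis.norm_apply_le_of_isC1AlphaH (fun A => (hFD A).coord i) hα h
    obtain ⟨hmono, hnn, hsum⟩ := hpow hα hM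
    have he' : ∀ s ∈ Icc (0 : ℝ) 1, ∀ t ∈ Icc (0 : ℝ) 1, |D (γ s) ((γ s)⁻¹ * γ t) i| ≤
        6 * (M * (9 * dist (γ s) (γ t) ^ 2) ^ (α / 2)) * dist (γ s) (γ t) :=
      fun s hs t ht => he (γ s) (γ t) (by rw [hlevel s hs t ht])
    have hna := fun κ (hκ : 0 < κ) => hγ.exists_nearlyAdditive hFD hD hmono hnn hsum he' hκ
    set S := ∑' k : ℕ, (1 / ((k : ℝ) + 1)) ^ (α / 2) / (k + 1) with hS
    have hS0 : 0 ≤ S := tsum_nonneg fun k => by positivity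
    set T := M * 9 ^ (α / 2) * (6 * 6 ^ (α / 2) * S) with hT
    have hT0 : 0 ≤ T := by positivity
    -- This `η` makes the final sewing constant `ε * (T / (T + 1))`, at most `ε`.
    obtain ⟨δ₀, hδ₀, hE⟩ := hγ.exists_abs_defect_le_modulus hFD hD hmono hnn he'
      (η := ε / (T + 1)) (by positivity)
    obtain ⟨δ, hδ, hfin⟩ := hγ.exists_arcEstimate_rpow hFD hD hna (β := α / 2)
      (K := ε / (T + 1) * (M * 9 ^ (α / 2))) (K' := ε) (by positivity) (by positivity) (by
        rw [← hS]
        calc ε / (T + 1) * (M * 9 ^ (α / 2)) * (6 * 6 ^ (α / 2) * S) = ε * (T / (T + 1)) := by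
              rw [hT]; ring
          _ ≤ ε * 1 := by
              gcongr
              exact (div_le_one (by positivity)).2 (by linarith)
          _ = ε := mul_one ε) hδ₀ (fun s u t hs hsu hut ht hd => by
        refine (hE s u t hs hsu hut ht hd).trans (le_of_eq ?_)
        rw [Real.mul_rpow (by norm_num) (le_max_of_le_left (sqDist_nonneg _ _ _))]
        ring)
    refine ⟨δ, hδ, fun s t hs hst ht hd => ?_⟩
    have := hfin s t hs hst ht hd
    rwa [Heis.sqDist_rpow_half] at this
  · obtain ⟨M, hM, he⟩ := Heis.norm_apply_le_of_isC1AlphaH hFD hα h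
    obtain ⟨hmono, hnn, hsum⟩ := hpow hα hM
    have he' : ∀ s ∈ Icc (0 : ℝ) 1, ∀ t ∈ Icc (0 : ℝ) 1, ‖D (γ s) ((γ s)⁻¹ * γ t)‖ ≤
        6 * (M * (9 * dist (γ s) (γ t) ^ 2) ^ (α / 2)) * dist (γ s) (γ t) :=
      fun s hs t ht => he (γ s) (γ t) (hlevel s hs t ht)
    have hna := fun κ (hκ : 0 < κ) => hγ.exists_nearlyAdditive hFD hD (i := 0) hmono hnn hsum
      (fun s hs t ht => (PiLp.norm_apply_le _ 0).trans (he' s hs t ht)) hκ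
    obtain ⟨C, hC, δ₀, hδ₀, hE⟩ := hγ.exists_abs_defect_le_mul hFD hD
    set S := ∑' k : ℕ, (1 / ((k : ℝ) + 1)) ^ α / (k + 1) with hS
    have hS0 : 0 ≤ S := tsum_nonneg fun k => by positivity
    -- Both factors of the defect now carry `6 * (M * (9 * N) ^ (α / 2))`; their product gives the
    -- exponent `α` in the squared distance and the constant `36 * M ^ 2 * 9 ^ α`.
    obtain ⟨δ, hδ, hfin⟩ := hγ.exists_arcEstimate_rpow hFD hD hna (β := α)
      (K := C * (36 * M ^ 2 * 9 ^ α)) hα (by positivity) le_rfl hδ₀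
      (fun s u t hs hsu hut ht hd => by
        have hs' : s ∈ Icc (0 : ℝ) 1 := ⟨hs, (hsu.trans hut).trans ht⟩
        have hu' : u ∈ Icc (0 : ℝ) 1 := ⟨hs.trans hsu, hut.trans ht⟩
        have ht' : t ∈ Icc (0 : ℝ) 1 := ⟨(hs.trans hsu).trans hut, ht⟩
        set N := max (sqDist γ s u) (sqDist γ u t) with hN
        have hN0 : 0 ≤ N := le_max_of_le_left (sqDist_nonneg _ _ _)
        set P := 6 * (M * (9 * N) ^ (α / 2)) with hP
        have hP0 : 0 ≤ P := by positivity
        have bound : ∀ v ∈ Icc (0 : ℝ) 1, dist (γ u) (γ v) ^ 2 ≤ N →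
            ‖D (γ u) ((γ u)⁻¹ * γ v)‖ ≤ P * dist (γ u) (γ v) := fun v hv hle => by
          refine (he' u hu' v hv).trans ?_
          rw [hP]
          gcongr
        have b1 := bound s hs' (by rw [dist_comm]; exact le_max_left _ _)
        have b2 := bound t ht' (le_max_right _ _)
        refine (hE s u t hs hsu hut ht hd 0 P P hP0 hP0 ((PiLp.norm_apply_le _ 0).trans b1)
          ((PiLp.norm_apply_le _ 0).trans b2) b1 b2).trans (le_of_eq ?_)
        have e : (9 * N) ^ (α / 2) * (9 * N) ^ (α / 2) = 9 ^ α * N ^ α := by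
          rw [← Real.mul_rpow (by norm_num) hN0, ← sq, ← Real.rpow_natCast, ← Real.rpow_mul
            (by positivity)]
          congr 1
          push_cast
          ring
        rw [← hN, hP]
        linear_combination C * 36 * M ^ 2 * N * e)
    refine hγ.exists_arcEstimate_of_small (α := 2 * α)
      (K := C * (36 * M ^ 2 * 9 ^ α) * (6 * 6 ^ α * S)) (by positivity) (by positivity) hδ
      fun s t hs hst ht hd => ?_
    have := hfin s t hs hst ht hd
    rw [← Heis.sqDist_rpow_half, mul_div_cancel_left₀ _ two_ne_zero]
    exact this
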